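/- Let $M,a\in\mathbb R$ with $0<|a|<M$, and put $r_\pm=M\pm\sqrt{M^2-a^2}$ and $\rho^2=r^2+a^2\cos^2\theta$. Let $K^*=(\mathbb R^2\times S^2)\setminus\Sigma$, with $(t^*,r)\in\mathbb R^2$, $(\theta,\phi^*)$ spherical coordinates on $S^2$ and $\Sigma=\{r=0,\ \theta=\pi/2\}$, be the Kerr-star spacetime, that is, the manifold with the Lorentzian metric $$\mathbf g=-\Big(1-\frac{2Mr}{\rho^2}\Big)(dt^*)^2-\frac{4Mar\sin^2\theta}{\rho^2}\,dt^*d\phi^*+\Big(r^2+a^2+\frac{2Mra^2\sin^2\theta}{\rho^2}\Big)\sin^2\theta\,(d\phi^*)^2+2\,dt^*dr-2a\sin^2\theta\,d\phi^*dr+\rho^2d\theta^2$$ (products of one-forms are symmetric products), extended smoothly over the axis $\{\theta=0,\pi\}$. Let $-\infty<\alpha<\beta\le\infty$ and let $\gamma:[\alpha,\beta)\to K^*$ be a null geodesic (affinely parametrized, with $\gamma'\neq0$ and $\mathbf g(\gamma',\gamma')=0$) that is maximal at $\beta$, i.e. that does not extend to a geodesic $[\alpha,\beta')\to K^*$ with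 $\beta'>\beta$. If $$\lim_{s\to\beta^-}r(\gamma(s))=r_+\qquad\text{or}\qquad\lim_{s\to\beta^-}r(\gamma(s))=r_-,$$ then $\gamma$ is unbounded: its image $\gamma([\alpha,\beta))$ is not contained in any compact subset of $K^*$. -/

import Mathlib

open Set Filter Topology
open scoped Manifold ContDiff

noncomputable section

namespace PseudoRiemannian

/-! Geodesics of a smooth manifold with a field `g` of bilinear forms on the tangent spaces. -/

variable {E : Type*} [NormedAddCommGroup E] [NormedSpace ℝ E]
  {H : Type*} [TopologicalSpace H] (I : ModelWithCorners ℝ E H)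
  {M : Type*} [TopologicalSpace M] [ChartedSpace H M]

/-- A field of (continuous) bilinear forms on the tangent spaces of `M`. -/
abbrev BilinearField : Type _ :=
  ∀ p : M, TangentSpace I p →L[ℝ] TangentSpace I p →L[ℝ] ℝ

variable {I}

/-- The coordinate expression of `g` in the chart `φ` around `p₀`: the value at the point `y` of the
model vector space `E` of the pullback `(φ⁻¹)^* g` on the pair of vectors `(u, v)`. -/
def chartMetric (g : BilinearField I (M := M)) (p₀ : M) (y u v : E) : ℝ :=
  g ((extChartAt I p₀).symm y)
    (mfderivWithin 𝓘(ℝ, E) I (extChartAt I p₀).symm (range I) y u)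
    (mfderivWithin 𝓘(ℝ, E) I (extChartAt I p₀).symm (range I) y v)

/-- The Christoffel symbol of the first kind of `g` in the chart around `p₀`, at `y`:
`Γ(u, v; w) = (∂_u g(v, w) + ∂_v g(u, w) - ∂_w g(u, v)) / 2`.
For basis vectors this is `g_{kl} Γ^l_{ij}`. -/
def christoffel (g : BilinearField I (M := M)) (p₀ : M) (y u v w : E) : ℝ :=
  (fderivWithin ℝ (fun z => chartMetric g p₀ z v w) (range I) y u
    + fderivWithin ℝ (fun z => chartMetric g p₀ z u w) (range I) y v
    - fderivWithin ℝ (fun z => chartMetric g p₀ z u v) (range I) y w) / 2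

/-- The velocity of a curve `γ` defined on the set `J` of parameters. -/
def velocity (I : ModelWithCorners ℝ E H) (γ : ℝ → M) (J : Set ℝ) (s : ℝ) :
    TangentSpace I (γ s) :=
  mfderivWithin 𝓘(ℝ, ℝ) I γ J s (1 : ℝ)

/-- The curve `γ`, with parameter domain the interval `J`, is an (affinely parametrized) geodesic of
the pseudo-Riemannian manifold given by the metric `g` on the open set `U`: it is of class `C²`,
stays in `U`, and satisfies the geodesic equation `c'' + Γ(c', c') = 0` in the chart around each of
its points. The equation is written with its index lowered by the (nondegenerate) metric:
`g(c'', w) + Γ(c', c'; w) = 0` for all `w`. At an end point that belongs to `J` the derivatives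
are one-sided; the values of `γ` outside `J` play no role. -/
structure IsGeodesicOn (g : BilinearField I (M := M)) (U : Set M) (γ : ℝ → M) (J : Set ℝ) :
    Prop where
  mapsTo : MapsTo γ J U
  contMDiffOn : ContMDiffOn 𝓘(ℝ, ℝ) I 2 γ J
  equation : ∀ s ∈ J, ∀ w : E,
    let c : ℝ → E := fun τ => extChartAt I (γ s) (γ τ)
    chartMetric g (γ s) (c s) (derivWithin (derivWithin c J) J s) w
      + christoffel g (γ s) (c s) (derivWithin c J s) (derivWithin c J s) w = 0

/-- A geodesic is null if its velocity is everywhere a null vector: nonzero, with `g(γ', γ') = 0`. -/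
structure IsNullGeodesicOn (g : BilinearField I (M := M)) (U : Set M) (γ : ℝ → M) (J : Set ℝ) :
    Prop extends IsGeodesicOn g U γ J where
  velocity_ne_zero : ∀ s ∈ J, velocity I γ J s ≠ 0
  null : ∀ s ∈ J, g (γ s) (velocity I γ J s) (velocity I γ J s) = 0

/-- The interval `[α, β)` of real parameters, where `β = ∞` is allowed. -/
def ray (α : ℝ) (β : EReal) : Set ℝ := {s | α ≤ s ∧ (s : EReal) < β}

/-- The filter `s → β⁻` on the real line, where `β = ∞` is allowed. -/
def toEnd (β : EReal) : Filter ℝ := comap (fun s : ℝ => (s : EReal)) (𝓝[<] β)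

/-- `γ : [α, β) → U` is maximal at `β`: it has no extension to a geodesic `[α, β') → U` with
`β' > β`. -/
def IsMaximalAtEnd (g : BilinearField I (M := M)) (U : Set M) (γ : ℝ → M) (α : ℝ) (β : EReal) :
    Prop :=
  ¬ ∃ (β' : EReal) (γ' : ℝ → M), β < β' ∧ IsGeodesicOn g U γ' (ray α β') ∧
    EqOn γ' γ (ray α β)

end PseudoRiemannian

namespace Kerr

/-- The unit sphere `S²` in Euclidean space `ℝ³`, with Mathlib's manifold structure. -/
abbrev S2 : Type := Metric.sphere (0 : EuclideanSpace ℝ (Fin 3)) 1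

/-- The manifold `ℝ² × S²`; its points are `(t^*, r, n)`, where `n` is the point of the sphere with
spherical coordinates `(θ, φ^*)`, that is, `n = (sin θ cos φ^*, sin θ sin φ^*, cos θ)`. -/
abbrev Total : Type := ℝ × ℝ × S2

/-- The model with corners of `ℝ² × S²` (no boundary). -/
abbrev model := (𝓘(ℝ, ℝ)).prod ((𝓘(ℝ, ℝ)).prod (𝓡 2))

/-- The coordinate function `t^*`. -/
def tStar (p : Total) : ℝ := p.1

/-- The coordinate function `r`. -/
def radius (p : Total) : ℝ := p.2.1

/-- The Cartesian coordinate functions of the point of the sphere: `i = 0, 1, 2` give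
`sin θ cos φ^*`, `sin θ sin φ^*`, `cos θ`. -/
def sph (i : Fin 3) (p : Total) : ℝ := (p.2.2 : EuclideanSpace ℝ (Fin 3)) i

/-- `ρ² = r² + a² cos² θ`. -/
def rhoSq (a : ℝ) (p : Total) : ℝ := radius p ^ 2 + a ^ 2 * sph 2 p ^ 2

/-- The ring singularity `Σ = {r = 0, θ = π/2}`. -/
def ringSingularity : Set Total := {p | radius p = 0 ∧ sph 2 p = 0}

/-- The Kerr-star manifold `K^* = (ℝ² × S²) \ Σ`. -/
def Kstar : Set Total := ringSingularityᶜ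

/-- The covectors at `p`. -/
abbrev Cotangent (p : Total) : Type := TangentSpace model p →L[ℝ] ℝ

/-- The differential at `p` of a function on `ℝ² × S²`. -/
def diff (f : Total → ℝ) (p : Total) : Cotangent p := mfderiv model 𝓘(ℝ, ℝ) f p

/-- The form `sin² θ dφ^*`, written as `x dy - y dx` so that it makes sense on the axis too. -/
def axial (p : Total) : Cotangent p := sph 0 p • diff (sph 1) p - sph 1 p • diff (sph 0) p

/-- The tensor product `(ξ ⊗ η)(u, v) = ξ(u) η(v)` of two covectors. -/
def tensor {p : Total} (ξ η : Cotangent p) :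
    TangentSpace model p →L[ℝ] TangentSpace model p →L[ℝ] ℝ :=
  ξ.smulRight η

/-- The round metric `dσ² = dθ ⊗ dθ + sin² θ dφ^* ⊗ dφ^*` of the unit sphere, that is,
`dx ⊗ dx + dy ⊗ dy + dz ⊗ dz` restricted to the sphere. -/
def round (p : Total) : TangentSpace model p →L[ℝ] TangentSpace model p →L[ℝ] ℝ :=
  ∑ i : Fin 3, tensor (diff (sph i) p) (diff (sph i) p)

/-- The Kerr metric in Kerr-star form, with mass `M` and rotation parameter `a`,
`-dt² + (2Mr/ρ²)(dt - a sin²θ dφ)² + 2 dt dr - 2 a sin²θ dφ dr + a² sin⁴θ dφ² + ρ² dσ²`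
(with `t = t^*`, `φ = φ^*` and symmetric products of covectors). Since
`a² sin⁴ θ + ρ² sin² θ = (r² + a²) sin² θ`, multiplying out the square gives the
coordinate expression
`-(1 - 2Mr/ρ²) dt² - (4Mar sin²θ/ρ²) dt dφ + (r² + a² + 2Mra² sin²θ/ρ²) sin²θ dφ²
  + 2 dt dr - 2 a sin²θ dφ dr + ρ² dθ²`. -/
def metric (M a : ℝ) : PseudoRiemannian.BilinearField model (M := Total) := fun p =>
  -tensor (diff tStar p) (diff tStar p)
  + (2 * M * radius p / rhoSq a p) •
      tensor (diff tStar p - a • axial p) (diff tStar p - a • axial p)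
  + (tensor (diff tStar p) (diff radius p) + tensor (diff radius p) (diff tStar p))
  - a • (tensor (axial p) (diff radius p) + tensor (diff radius p) (axial p))
  + a ^ 2 • tensor (axial p) (axial p)
  + rhoSq a p • round p

/-- The outer horizon radius `r_+ = M + √(M² - a²)`. -/
def rPlus (M a : ℝ) : ℝ := M + Real.sqrt (M ^ 2 - a ^ 2)

/-- The inner horizon radius `r_- = M - √(M² - a²)`. -/
def rMinus (M a : ℝ) : ℝ := M - Real.sqrt (M ^ 2 - a ^ 2)

/-- The curve `γ : [α, β) → K^*` tends to a horizon `{r = r_+}` or `{r = r_-}` as `s → β⁻`. -/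
def TendsToHorizon (M a : ℝ) (γ : ℝ → Total) (β : EReal) : Prop :=
  Tendsto (fun s => radius (γ s)) (PseudoRiemannian.toEnd β) (𝓝 (rPlus M a)) ∨
  Tendsto (fun s => radius (γ s)) (PseudoRiemannian.toEnd β) (𝓝 (rMinus M a))

/-- The curve `γ` with parameter domain `J` is bounded in `K^*`: its image is contained in a compact
subset of `K^*`. -/
def IsBoundedInKstar (γ : ℝ → Total) (J : Set ℝ) : Prop :=
  ∃ C : Set Total, IsCompact C ∧ C ⊆ Kstar ∧ γ '' J ⊆ C

end Kerr

end

noncomputable section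

/-! ### The embedding of `ℝ² × S²` in `ℝ² × ℝ³`, and its charts. -/

namespace Kerr

open PseudoRiemannian

/-! Suppose that the image lies in a compact subset of `K^*`, so that `t^*` is bounded. The whole
proof rests on the function w = g(γ', ∂_r). Let E and L be the energy and the angular momentum,
given by Noether's identity `hasDerivAt_momentum` for the Killing fields ∂_t and ∂_φ. Put Δ = r² -
2Mr + a², P = (r² + a²)E - aL, D = L - aE sin²θ. Then ρ² t' = (r² + a²)w + aD and ρ² r' = Δw - P,
and nullity makes w solve w' = w (2rE - (r - M)w)/ρ². The Carter constant is K = w(2P - Δw), a sum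
of squares that controls the angular velocity. These facts are collected in `exists_reducedSystem`.

Let r_h be the horizon approached and r_o the other one. Near r_h the derivatives of t and of log|w|
are governed by w, with coefficients that at r_h are in the ratio 2M r_h : -(r_h - M). Hence (r_h -
M)t + 2M r_h log|w| loses its w-term at the horizon, and adding -(r_h - M)r + 2M² log|r - r_o|
removes it identically (`ReducedSystem.hasDerivAt_regular`). What remains has a bounded derivative,
so bounds on t and on w are linked.

If β is finite, bounded t therefore bounds w from above (`exists_bound_w`); then the time, radial
and Carter equations bound the velocity, and a geodesic with bounded velocity in a compact set
extends past β (`not_isMaximalAtEnd_of_bounded_velocity`), against maximality.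

If β = ∞, `unbounded_of_tendsto` distinguishes three cases. Since (ρ² r')² = P² - ΔK, if P(r_h) ≠ 0
then r' stays away from 0 and r is unbounded. If P(r_h) = 0 and K ≠ 0, then P and Δ tend to 0, which
forces |w| to infinity and makes t unbounded. If P(r_h) = 0 and K = 0, then E = L = 0 and the curve
stays in the horizon; the regular combination is now constant, so bounded t keeps |w|, hence |t'|,
away from 0, a contradiction again.

To avoid coordinates singular on the axis, curves are viewed in `ℝ² × ℝ³`, where the metric is given
by a rational formula and the geodesic equation is tested only against vectors tangent to the
sphere. -/

/-- The model vector space of `ℝ² × S²`. -/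
abbrev Mod : Type := ℝ × ℝ × EuclideanSpace ℝ (Fin 2)

/-- The vector space `ℝ² × ℝ³`, in which `ℝ² × S²` is embedded. -/
abbrev Amb : Type := ℝ × ℝ × EuclideanSpace ℝ (Fin 3)

/-- The inclusion of `ℝ² × S²` in `ℝ² × ℝ³`. -/
def incl (p : Total) : Amb := (p.1, p.2.1, (p.2.2 : EuclideanSpace ℝ (Fin 3)))

/-- The inverse of the chart of `ℝ² × S²` at `p`, as a map to `ℝ² × ℝ³`. -/
def param (p : Total) (y : Mod) : Amb := incl ((extChartAt model p).symm y)

/-- The linear coordinates of the factor `ℝ³`. -/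
def dn (i : Fin 3) : Amb →L[ℝ] ℝ :=
  (EuclideanSpace.proj i).comp
    ((ContinuousLinearMap.snd ℝ ℝ _).comp (ContinuousLinearMap.snd ℝ ℝ _))

/-- The coordinate `t^*` on the ambient space. -/
def dt : Amb →L[ℝ] ℝ := ContinuousLinearMap.fst ℝ ℝ _

/-- The coordinate `r` on the ambient space. -/
def dr : Amb →L[ℝ] ℝ :=
  (ContinuousLinearMap.fst ℝ ℝ _).comp (ContinuousLinearMap.snd ℝ ℝ _)

@[simp] lemma dn_apply (i : Fin 3) (X : Amb) : dn i X = X.2.2 i := rfl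
@[simp] lemma dt_apply (X : Amb) : dt X = X.1 := rfl
@[simp] lemma dr_apply (X : Amb) : dr X = X.2.1 := rfl

/-- The form `x dy - y dx` on the ambient space. -/
def ambAxial (X : Amb) : Amb →L[ℝ] ℝ := X.2.2 0 • dn 1 - X.2.2 1 • dn 0

/-- The function `ρ²` on the ambient space. -/
def ambRho (a : ℝ) (X : Amb) : ℝ := X.2.1 ^ 2 + a ^ 2 * X.2.2 2 ^ 2

/-- The extension of the Kerr metric to the ambient space given by the same formula. -/
def ambMetric (M a : ℝ) (X : Amb) : Amb →L[ℝ] Amb →L[ℝ] ℝ :=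
  -dt.smulRight dt
  + (2 * M * X.2.1 / ambRho a X) • (dt - a • ambAxial X).smulRight (dt - a • ambAxial X)
  + (dt.smulRight dr + dr.smulRight dt)
  - a • ((ambAxial X).smulRight dr + dr.smulRight (ambAxial X))
  + a ^ 2 • (ambAxial X).smulRight (ambAxial X)
  + ambRho a X • ∑ i : Fin 3, (dn i).smulRight (dn i)

lemma finrank_euclidean_three : Fact (Module.finrank ℝ (EuclideanSpace ℝ (Fin 3)) = 2 + 1) :=
  ⟨by simp⟩

/-- The inclusion of the sphere in `ℝ³`. -/
def sphereIncl (n : S2) : EuclideanSpace ℝ (Fin 3) := n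

lemma contMDiff_sphereIncl : ContMDiff (𝓡 2) 𝓘(ℝ, EuclideanSpace ℝ (Fin 3)) ∞ sphereIncl :=
  have := finrank_euclidean_three
  contMDiff_coe_sphere

/-- The differential of the inclusion of the sphere in `ℝ³`, as a map of vector spaces. -/
def sphereDeriv (n : S2) : EuclideanSpace ℝ (Fin 2) →L[ℝ] EuclideanSpace ℝ (Fin 3) :=
  mfderiv (𝓡 2) 𝓘(ℝ, EuclideanSpace ℝ (Fin 3)) sphereIncl n

lemma sphereDeriv_injective (n : S2) : Function.Injective (sphereDeriv n) :=
  have := finrank_euclidean_three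
  injective_mvfderiv_subtypeVal_sphere n

lemma mem_range_sphereDeriv (n : S2) (x : EuclideanSpace ℝ (Fin 3)) :
    (∃ z, sphereDeriv n z = x) ↔ inner ℝ (sphereIncl n) x = 0 := by
  have := finrank_euclidean_three
  have hr := range_mvfderiv_subtypeVal (E := EuclideanSpace ℝ (Fin 3)) (n := 2) n
  refine Iff.trans ?_ (Submodule.mem_orthogonal_singleton_iff_inner_right
    (𝕜 := ℝ) (u := sphereIncl n) (v := x))
  refine Iff.trans ?_ (iff_of_eq (congrArg (x ∈ ·) hr))
  rfl

/-- The charts of the sphere are stereographic projections, which are onto the plane. Thus `param p`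
is smooth on the whole model space and no chart domains have to be tracked there. -/
lemma extChartAt_target_eq (p : Total) : (extChartAt model p).target = univ := by
  have h1 : ∀ x : ℝ, (extChartAt 𝓘(ℝ, ℝ) x).target = univ := fun x => by
    simp only [mfld_simps, chartAt_self_eq]
  have h2 : (extChartAt (𝓡 2) p.2.2).target = univ := by
    rw [extChartAt_target, ModelWithCorners.range_eq_univ, inter_univ]
    have := finrank_euclidean_three
    have : (chartAt (EuclideanSpace ℝ (Fin 2)) p.2.2).target = univ := stereographic'_target _
    rw [this]
    rfl
  rw [extChartAt_prod, extChartAt_prod, PartialEquiv.prod_target, PartialEquiv.prod_target,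
    h1, h1, h2, univ_prod_univ, univ_prod_univ]

lemma contMDiff_incl : ContMDiff model 𝓘(ℝ, Amb) ∞ incl := by
  unfold incl
  refine ContMDiff.prodMk_space contMDiff_fst ((contMDiff_fst.comp contMDiff_snd).prodMk_space ?_)
  exact contMDiff_sphereIncl.comp (contMDiff_snd.comp contMDiff_snd)

lemma contMDiff_extChartAt_symm (p : Total) :
    ContMDiff 𝓘(ℝ, Mod) model ∞ (extChartAt model p).symm := by
  have := contMDiffOn_extChartAt_symm (I := model) (n := ∞) p
  rwa [extChartAt_target_eq, contMDiffOn_univ] at this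

lemma contDiff_param (p : Total) : ContDiff ℝ ∞ (param p) :=
  (contMDiff_incl.comp (contMDiff_extChartAt_symm p)).contDiff

lemma fderiv_param (p : Total) (y : Mod) :
    fderiv ℝ (param p) y = (mfderiv model 𝓘(ℝ, Amb) incl ((extChartAt model p).symm y)).comp
      (mfderivWithin 𝓘(ℝ, Mod) model (extChartAt model p).symm (range model) y) := by
  rw [ModelWithCorners.range_eq_univ, mfderivWithin_univ, ← mfderiv_eq_fderiv]
  exact mfderiv_comp y (contMDiff_incl.mdifferentiable (by simp) _)
    ((contMDiff_extChartAt_symm p).mdifferentiable (by simp) _)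

lemma mfderiv_comp_incl {F : Type*} [NormedAddCommGroup F] [NormedSpace ℝ F] (f : Amb →L[ℝ] F)
    (p : Total) :
    mfderiv model 𝓘(ℝ, F) (fun q => f (incl q)) p
      = f.comp (mfderiv model 𝓘(ℝ, Amb) incl p) := by
  have := mfderiv_comp (I := model) (I' := 𝓘(ℝ, Amb)) (I'' := 𝓘(ℝ, F)) p
    (g := f) (f := incl) f.differentiableAt.mdifferentiableAt
    (contMDiff_incl.mdifferentiable (by simp) _)
  rw [mfderiv_eq_fderiv, f.fderiv] at this
  exact this

/-- The differential of the inclusion `ℝ² × S² → ℝ² × ℝ³`. -/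
lemma mfderiv_incl_apply (p : Total) (u : Mod) :
    (mfderiv model 𝓘(ℝ, Amb) incl p u : Amb)
      = (u.1, u.2.1, sphereDeriv p.2.2 u.2.2) := by
  have hsm : MDifferentiableAt (𝓡 2) 𝓘(ℝ, EuclideanSpace ℝ (Fin 3)) sphereIncl p.2.2 :=
    contMDiff_sphereIncl.mdifferentiable (by simp) _
  have hs2 : HasMFDerivAt model (𝓡 2) (fun q : Total => q.2.2) p
      ((ContinuousLinearMap.snd ℝ ℝ (EuclideanSpace ℝ (Fin 2))).comp
        (ContinuousLinearMap.snd ℝ ℝ (ℝ × EuclideanSpace ℝ (Fin 2)))) :=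
    HasMFDerivAt.comp (f := fun q : Total => q.2) p (hasMFDerivAt_snd _) (hasMFDerivAt_snd _)
  have hs1 : HasMFDerivAt model 𝓘(ℝ, ℝ) (fun q : Total => q.2.1) p
      ((ContinuousLinearMap.fst ℝ ℝ (EuclideanSpace ℝ (Fin 2))).comp
        (ContinuousLinearMap.snd ℝ ℝ (ℝ × EuclideanSpace ℝ (Fin 2)))) :=
    HasMFDerivAt.comp (f := fun q : Total => q.2) p (hasMFDerivAt_fst _) (hasMFDerivAt_snd _)
  have h1 := mfderiv_comp_incl dt p
  have h2 := mfderiv_comp_incl dr p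
  have h3 := mfderiv_comp_incl ((ContinuousLinearMap.snd ℝ ℝ (EuclideanSpace ℝ (Fin 3))).comp
    (ContinuousLinearMap.snd ℝ ℝ (ℝ × EuclideanSpace ℝ (Fin 3)))) p
  have h1' : HasMFDerivAt model 𝓘(ℝ, ℝ) (fun q => dt (incl q)) p
    (ContinuousLinearMap.fst ℝ ℝ (ℝ × EuclideanSpace ℝ (Fin 2))) := hasMFDerivAt_fst _
  have h2' : HasMFDerivAt model 𝓘(ℝ, ℝ) (fun q => dr (incl q)) p _ := hs1
  have h3' := hsm.hasMFDerivAt.comp p hs2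
  rw [h1'.mfderiv] at h1
  rw [h2'.mfderiv] at h2
  have h3 := h3'.mfderiv.symm.trans h3
  refine Prod.ext ?_ (Prod.ext ?_ ?_)
  · exact (DFunLike.congr_fun h1 u).symm
  · exact (DFunLike.congr_fun h2 u).symm
  · exact (DFunLike.congr_fun h3 u).symm

lemma mfderiv_incl_injective (p : Total) :
    Function.Injective (mfderiv model 𝓘(ℝ, Amb) incl p) := by
  intro u v h
  have h' := (mfderiv_incl_apply p u).symm.trans (h.trans (mfderiv_incl_apply p v))
  obtain ⟨h1, h2⟩ := Prod.mk.inj h'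
  obtain ⟨h2, h3⟩ := Prod.mk.inj h2
  exact Prod.ext h1 (Prod.ext h2 (sphereDeriv_injective _ h3))

lemma mem_range_mfderiv_incl (p : Total) (W : Amb) :
    W ∈ range (mfderiv model 𝓘(ℝ, Amb) incl p) ↔ inner ℝ (incl p).2.2 W.2.2 = 0 := by
  constructor
  · rintro ⟨u, rfl⟩
    refine (congrArg (fun z : Amb => inner ℝ (incl p).2.2 z.2.2) (mfderiv_incl_apply p u)).trans ?_
    exact (mem_range_sphereDeriv p.2.2 _).1 ⟨_, rfl⟩
  · intro h
    obtain ⟨z, hz⟩ := (mem_range_sphereDeriv p.2.2 W.2.2).2 h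
    refine ⟨((W.1, W.2.1, z) : Mod), (mfderiv_incl_apply p _).trans ?_⟩
    exact Prod.ext rfl (Prod.ext rfl hz)

/-- All the forms that build the metric are pullbacks of forms on the ambient space, so the metric
is a pullback too. -/
lemma metric_eq (M a : ℝ) (p : Total) (u v : TangentSpace model p) :
    metric M a p u v = ambMetric M a (incl p) (mfderiv model 𝓘(ℝ, Amb) incl p u)
      (mfderiv model 𝓘(ℝ, Amb) incl p v) := by
  have h1 : diff tStar p = dt.comp (mfderiv model 𝓘(ℝ, Amb) incl p) := mfderiv_comp_incl dt p
  have h2 : diff radius p = dr.comp (mfderiv model 𝓘(ℝ, Amb) incl p) := mfderiv_comp_incl dr p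
  have h3 : ∀ i, diff (sph i) p = (dn i).comp (mfderiv model 𝓘(ℝ, Amb) incl p) :=
    fun i => mfderiv_comp_incl (dn i) p
  unfold metric axial round
  simp only [h1, h2, h3]
  rfl

lemma chartMetric_eq (M a : ℝ) (p : Total) (y u v : Mod) :
    chartMetric (metric M a) p y u v
      = ambMetric M a (param p y) (fderiv ℝ (param p) y u) (fderiv ℝ (param p) y v) := by
  unfold chartMetric
  rw [metric_eq, fderiv_param]
  rfl

lemma bijective_mfderivWithin_symm (p : Total) (y : Mod) :
    Function.Bijective
      (mfderivWithin 𝓘(ℝ, Mod) model (extChartAt model p).symm (range model) y) :=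
  (isInvertible_mfderivWithin_extChartAt_symm (x := p)
    (by rw [extChartAt_target_eq]; trivial)).bijective

lemma fderiv_param_injective (p : Total) (y : Mod) :
    Function.Injective (fderiv ℝ (param p) y) := by
  rw [fderiv_param]
  exact (mfderiv_incl_injective _).comp (bijective_mfderivWithin_symm p y).1

lemma mem_range_fderiv_param (p : Total) (y : Mod) (W : Amb) :
    (∃ w, fderiv ℝ (param p) y w = W) ↔ inner ℝ (param p y).2.2 W.2.2 = 0 := by
  rw [fderiv_param]
  refine Iff.trans ?_ (mem_range_mfderiv_incl ((extChartAt model p).symm y) W)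
  constructor
  · rintro ⟨w, rfl⟩
    exact ⟨_, rfl⟩
  · rintro ⟨z, rfl⟩
    obtain ⟨w, rfl⟩ := (bijective_mfderivWithin_symm p y).2 z
    exact ⟨w, rfl⟩

lemma param_extChartAt (p q : Total) (hq : q ∈ (extChartAt model p).source) :
    param p (extChartAt model p q) = incl q := by
  rw [param, (extChartAt model p).left_inv hq]

end Kerr

/-! ### The geodesic equation of a pulled back metric. -/

namespace PseudoRiemannian

section Pullback

variable {E V : Type*} [NormedAddCommGroup E] [NormedSpace ℝ E]
  [NormedAddCommGroup V] [NormedSpace ℝ V]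

/-- The left-hand side of the geodesic equation with lowered index, for the metric `G` on a vector
space, at the point `X` with first derivative `X₁` and second derivative `X₂`, applied to `W`. -/
def eulerLagrange (G : V → V →L[ℝ] V →L[ℝ] ℝ) (X X₁ X₂ W : V) : ℝ :=
  G X X₂ W + fderiv ℝ G X X₁ X₁ W - fderiv ℝ G X W X₁ X₁ / 2

lemma fderiv_pullback {G : V → V →L[ℝ] V →L[ℝ] ℝ} {ψ : E → V} {y : E}
    (hG : DifferentiableAt ℝ G (ψ y)) (hψ : ContDiffAt ℝ 2 ψ y) (u v w : E) :
    fderiv ℝ (fun z => G (ψ z) (fderiv ℝ ψ z v) (fderiv ℝ ψ z w)) y u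
      = fderiv ℝ G (ψ y) (fderiv ℝ ψ y u) (fderiv ℝ ψ y v) (fderiv ℝ ψ y w)
        + G (ψ y) (fderiv ℝ (fderiv ℝ ψ) y u v) (fderiv ℝ ψ y w)
        + G (ψ y) (fderiv ℝ ψ y v) (fderiv ℝ (fderiv ℝ ψ) y u w) := by
  have h1 : HasFDerivAt ψ (fderiv ℝ ψ y) y := (hψ.differentiableAt (by simp)).hasFDerivAt
  have h2 : HasFDerivAt (fderiv ℝ ψ) (fderiv ℝ (fderiv ℝ ψ) y) y :=
    ((hψ.fderiv_right (m := 1) (by norm_num)).differentiableAt (by simp)).hasFDerivAt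
  have h3 : HasFDerivAt (fun z => G (ψ z)) ((fderiv ℝ G (ψ y)).comp (fderiv ℝ ψ y)) y :=
    HasFDerivAt.comp (g := G) y hG.hasFDerivAt h1
  have h4 := (h3.clm_apply (h2.clm_apply (hasFDerivAt_const v y))).clm_apply
    (h2.clm_apply (hasFDerivAt_const w y))
  rw [h4.fderiv]
  simp
  ring

/-- Naturality of the geodesic equation. By the chain rule the Christoffel terms produce second
derivatives of `ψ`; those in which `w` is differentiated cancel by the symmetry of `G` and of the
second derivative. The surviving one is the extra term in the second derivative of the curve `ψ ∘
c`. -/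
lemma eulerLagrange_pullback {G : V → V →L[ℝ] V →L[ℝ] ℝ} {ψ : E → V} {y : E}
    (hG : DifferentiableAt ℝ G (ψ y)) (hψ : ContDiffAt ℝ 2 ψ y)
    (hs : ∀ u v, G (ψ y) u v = G (ψ y) v u) (c₁ c₂ w : E) :
    G (ψ y) (fderiv ℝ ψ y c₂) (fderiv ℝ ψ y w)
      + (fderiv ℝ (fun z => G (ψ z) (fderiv ℝ ψ z c₁) (fderiv ℝ ψ z w)) y c₁
        + fderiv ℝ (fun z => G (ψ z) (fderiv ℝ ψ z c₁) (fderiv ℝ ψ z w)) y c₁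
        - fderiv ℝ (fun z => G (ψ z) (fderiv ℝ ψ z c₁) (fderiv ℝ ψ z c₁)) y w) / 2
      = eulerLagrange G (ψ y) (fderiv ℝ ψ y c₁)
          (fderiv ℝ (fderiv ℝ ψ) y c₁ c₁ + fderiv ℝ ψ y c₂) (fderiv ℝ ψ y w) := by
  have hsym : fderiv ℝ (fderiv ℝ ψ) y w c₁ = fderiv ℝ (fderiv ℝ ψ) y c₁ w :=
    (hψ.isSymmSndFDerivAt (by simp)).eq w c₁
  simp only [fderiv_pullback hG hψ, eulerLagrange, hsym, map_add, add_apply]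
  rw [hs (fderiv ℝ (fderiv ℝ ψ) y c₁ w)]
  ring

lemma differentiableAt_deriv {c : ℝ → E} {s : ℝ} (hc : ContDiffAt ℝ 2 c s) :
    DifferentiableAt ℝ (deriv c) s := by
  have h := (hc.fderiv_right (m := 1) (by norm_num)).differentiableAt (by simp)
  exact h.clm_apply (differentiableAt_const (1 : ℝ))

lemma deriv_comp_param {ψ : E → V} {c : ℝ → E} {s : ℝ}
    (hψ : ContDiff ℝ 2 ψ) (hc : ContDiffAt ℝ 2 c s) :
    deriv (fun τ => ψ (c τ)) s = fderiv ℝ ψ (c s) (deriv c s) :=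
  ((hψ.contDiffAt.differentiableAt (by simp)).hasFDerivAt.comp_hasDerivAt s
    (hc.differentiableAt (by simp)).hasDerivAt).deriv

lemma deriv_deriv_comp_param {ψ : E → V} {c : ℝ → E} {s : ℝ}
    (hψ : ContDiff ℝ 2 ψ) (hc : ContDiffAt ℝ 2 c s) :
    deriv (deriv (fun τ => ψ (c τ))) s
      = fderiv ℝ (fderiv ℝ ψ) (c s) (deriv c s) (deriv c s)
        + fderiv ℝ ψ (c s) (deriv (deriv c) s) := by
  have hev : deriv (fun τ => ψ (c τ)) =ᶠ[𝓝 s] fun τ => fderiv ℝ ψ (c τ) (deriv c τ) := by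
    filter_upwards [hc.eventually (by simp)] with τ hτ using deriv_comp_param hψ hτ
  rw [hev.deriv_eq]
  have h1 : HasFDerivAt (fderiv ℝ ψ) (fderiv ℝ (fderiv ℝ ψ) (c s)) (c s) :=
    ((hψ.contDiffAt.fderiv_right (m := 1) (by norm_num)).differentiableAt (by simp)).hasFDerivAt
  have h2 := h1.comp_hasDerivAt s (hc.differentiableAt (by simp)).hasDerivAt
  have h3 : HasDerivAt (deriv c) (deriv (deriv c) s) s :=
    (differentiableAt_deriv hc).hasDerivAt
  exact (h2.clm_apply h3).deriv

end Pullback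

end PseudoRiemannian

/-! ### The ambient metric and the chart form of its geodesic equation. -/

namespace Kerr

open PseudoRiemannian

lemma contDiffAt_ambMetric (M a : ℝ) {X : Amb} (hX : ambRho a X ≠ 0) {n : WithTop ℕ∞} :
    ContDiffAt ℝ n (ambMetric M a) X := by
  have h0 : ∀ i, ContDiffAt ℝ n (fun X : Amb => X.2.2 i) X := fun i => (dn i).contDiff.contDiffAt
  have h1 : ContDiffAt ℝ n (fun X : Amb => X.2.1) X := dr.contDiff.contDiffAt
  have h2 : ContDiffAt ℝ n (ambRho a) X := (h1.pow 2).add (contDiffAt_const.mul ((h0 2).pow 2))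
  have h3 : ContDiffAt ℝ n ambAxial X :=
    ((h0 0).smul contDiffAt_const).sub ((h0 1).smul contDiffAt_const)
  have h4 : ContDiffAt ℝ n (fun X => dt - a • ambAxial X) X :=
    contDiffAt_const.sub (h3.const_smul a)
  have h5 : ContDiffAt ℝ n (fun X : Amb => 2 * M * X.2.1 / ambRho a X) X :=
    (contDiffAt_const.mul h1).div h2 hX
  unfold ambMetric
  exact ((((contDiffAt_const.add (h5.smul (h4.smulRight h4))).add contDiffAt_const).sub
    (ContDiffAt.const_smul a ((h3.smulRight contDiffAt_const).add
      (contDiffAt_const.smulRight h3)))).add ((h3.smulRight h3).const_smul (a ^ 2))).add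
      (h2.smul contDiffAt_const)

/-- The form `x dy - y dx` at the point with Cartesian coordinates `X`, applied to `u`. -/
lemma ambAxial_apply (X u : Amb) :
    ambAxial X u = X.2.2 0 * u.2.2 1 - X.2.2 1 * u.2.2 0 := rfl

lemma ambMetric_apply (M a : ℝ) (X u v : Amb) :
    ambMetric M a X u v = -(u.1 * v.1)
      + 2 * M * X.2.1 / ambRho a X * ((u.1 - a * ambAxial X u) * (v.1 - a * ambAxial X v))
      + (u.1 * v.2.1 + u.2.1 * v.1)
      - a * (ambAxial X u * v.2.1 + u.2.1 * ambAxial X v)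
      + a ^ 2 * (ambAxial X u * ambAxial X v)
      + ambRho a X * (u.2.2 0 * v.2.2 0 + u.2.2 1 * v.2.2 1 + u.2.2 2 * v.2.2 2) := by
  unfold ambMetric
  rw [Fin.sum_univ_three]
  rfl

lemma ambMetric_symm (M a : ℝ) (X u v : Amb) :
    ambMetric M a X u v = ambMetric M a X v u := by
  rw [ambMetric_apply, ambMetric_apply]
  ring

lemma inner_amb (x y : EuclideanSpace ℝ (Fin 3)) :
    inner ℝ x y = x 0 * y 0 + x 1 * y 1 + x 2 * y 2 := by
  simp [PiLp.inner_apply, Fin.sum_univ_three, mul_comm]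

lemma eq_zero_of_sum_sq_eq_zero {x y z : ℝ} (h : x ^ 2 + y ^ 2 + z ^ 2 = 0) :
    x = 0 ∧ y = 0 ∧ z = 0 := by
  refine ⟨?_, ?_, ?_⟩ <;>
    exact pow_eq_zero_iff two_ne_zero |>.1
      (by linarith [sq_nonneg x, sq_nonneg y, sq_nonneg z])

/-- The Kerr metric is nondegenerate on the tangent spaces. -/
lemma ambMetric_nondegenerate (M a : ℝ) {X U : Amb} (hX : ambRho a X ≠ 0)
    (hU : inner ℝ X.2.2 U.2.2 = 0)
    (h : ∀ W : Amb, inner ℝ X.2.2 W.2.2 = 0 → ambMetric M a X U W = 0) : U = 0 := by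
  -- Testing with ∂_r gives `U.1 = a q`, which kills the term in M; ∂_t then gives `U.2.1 = U.1`;
  -- finally, against the sphere component of `U` only `ρ²` times its squared length survives.
  have hr := h (0, 1, 0) (by simp)
  have ht := h (1, 0, 0) (by simp)
  have hn := h (0, 0, U.2.2) hU
  simp only [ambMetric_apply, ambAxial_apply, PiLp.zero_apply] at hr ht hn
  set q := X.2.2 0 * U.2.2 1 - X.2.2 1 * U.2.2 0
  have h1 : U.1 = a * q := by linarith
  have h2 : U.2.1 = U.1 := by rw [h1] at ht ⊢; linear_combination ht
  rw [h2, h1] at hn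
  have h3 : ambRho a X * (U.2.2 0 ^ 2 + U.2.2 1 ^ 2 + U.2.2 2 ^ 2) = 0 := by
    linear_combination hn
  have h4 := (mul_eq_zero.1 h3).resolve_left hX
  obtain ⟨e0, e1, e2⟩ := eq_zero_of_sum_sq_eq_zero h4
  have hq : q = 0 := by simp [q, e0, e1]
  have h5 : U.1 = 0 := by rw [h1, hq, mul_zero]
  refine Prod.ext h5 (Prod.ext (h2.trans h5) ?_)
  ext i
  fin_cases i
  · exact e0
  · exact e1
  · exact e2

/-- The geodesic equation in the chart at `p`, in terms of the inclusion in `ℝ² × ℝ³`. -/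
lemma chart_equation_iff (M a : ℝ) (p : Total) {c : ℝ → Mod} {s : ℝ} (hc : ContDiffAt ℝ 2 c s)
    (hρ : ambRho a (param p (c s)) ≠ 0) :
    (∀ w : Mod, chartMetric (metric M a) p (c s) (deriv (deriv c) s) w
        + christoffel (metric M a) p (c s) (deriv c s) (deriv c s) w = 0) ↔
    ∀ W : Amb, inner ℝ (param p (c s)).2.2 W.2.2 = 0 →
      eulerLagrange (ambMetric M a) (param p (c s)) (deriv (fun τ => param p (c τ)) s)
        (deriv (deriv (fun τ => param p (c τ))) s) W = 0 := by
  have hψ : ContDiff ℝ 2 (param p) := contDiff_infty.1 (contDiff_param p) 2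
  rw [deriv_comp_param hψ hc, deriv_deriv_comp_param hψ hc]
  have key : ∀ w : Mod, chartMetric (metric M a) p (c s) (deriv (deriv c) s) w
        + christoffel (metric M a) p (c s) (deriv c s) (deriv c s) w
      = eulerLagrange (ambMetric M a) (param p (c s)) (fderiv ℝ (param p) (c s) (deriv c s))
        (fderiv ℝ (fderiv ℝ (param p)) (c s) (deriv c s) (deriv c s)
          + fderiv ℝ (param p) (c s) (deriv (deriv c) s)) (fderiv ℝ (param p) (c s) w) := by
    intro w
    rw [← eulerLagrange_pullback ((contDiffAt_ambMetric M a hρ (n := 1)).differentiableAt (by simp))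
      hψ.contDiffAt (ambMetric_symm M a _)]
    simp only [christoffel, chartMetric_eq, ModelWithCorners.range_eq_univ, fderivWithin_univ]
  simp only [key, ← mem_range_fderiv_param]
  constructor
  · rintro h W ⟨w, rfl⟩
    exact h w
  · exact fun h w => h _ ⟨w, rfl⟩

end Kerr

/-! ### Geodesics of `K^*` as curves in the ambient space. -/

namespace Kerr

open PseudoRiemannian

/-- The geodesic equation for a curve in `ℝ² × S²`, regarded as a curve in `ℝ² × ℝ³`. -/
def AmbientEquation (M a : ℝ) (X : ℝ → Amb) (s : ℝ) : Prop :=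
  ∀ W : Amb, inner ℝ (X s).2.2 W.2.2 = 0 →
    eulerLagrange (ambMetric M a) (X s) (deriv X s) (deriv (deriv X) s) W = 0

lemma AmbientEquation.congr {M a : ℝ} {X Y : ℝ → Amb} {s : ℝ} (h : X =ᶠ[𝓝 s] Y)
    (hX : AmbientEquation M a X s) : AmbientEquation M a Y s := by
  unfold AmbientEquation at *
  rwa [← h.eq_of_nhds, ← h.deriv_eq, ← h.deriv.deriv_eq]

lemma contDiffAt_extChartAt_comp {q : Total} {γ : ℝ → Total} {s : ℝ}
    (hγ : ContMDiffAt 𝓘(ℝ, ℝ) model 2 γ s) (hq : γ s ∈ (extChartAt model q).source) :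
    ContDiffAt ℝ 2 (fun τ => extChartAt model q (γ τ)) s := by
  rw [extChartAt_source] at hq
  exact ((contMDiffAt_extChartAt' hq).comp s hγ).contDiffAt

lemma param_extChartAt_eventuallyEq {q : Total} {γ : ℝ → Total} {s : ℝ}
    (hγ : ContinuousAt γ s) (hq : γ s ∈ (extChartAt model q).source) :
    (fun τ => param q (extChartAt model q (γ τ))) =ᶠ[𝓝 s] fun τ => incl (γ τ) := by
  filter_upwards [hγ.preimage_mem_nhds ((isOpen_extChartAt_source q).mem_nhds hq)] with τ hτ
  exact param_extChartAt q _ hτ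

lemma chart_equation_iff_ambientEquation (M a : ℝ) {q : Total} {γ : ℝ → Total} {s : ℝ}
    (hγ : ContMDiffAt 𝓘(ℝ, ℝ) model 2 γ s) (hq : γ s ∈ (extChartAt model q).source)
    (hρ : ambRho a (incl (γ s)) ≠ 0) :
    (∀ w : Mod, chartMetric (metric M a) q (extChartAt model q (γ s))
        (deriv (deriv (fun τ => extChartAt model q (γ τ))) s) w
        + christoffel (metric M a) q (extChartAt model q (γ s))
          (deriv (fun τ => extChartAt model q (γ τ)) s)
          (deriv (fun τ => extChartAt model q (γ τ)) s) w = 0) ↔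
    AmbientEquation M a (fun τ => incl (γ τ)) s := by
  have he := param_extChartAt_eventuallyEq hγ.continuousAt hq
  refine (chart_equation_iff M a q (contDiffAt_extChartAt_comp hγ hq) ?_).trans
    ⟨fun h => AmbientEquation.congr he h, fun h => AmbientEquation.congr he.symm h⟩
  rwa [param_extChartAt q _ hq]

/-- At interior parameters the derivatives within `J` are ordinary ones, and the ambient form of the
equation does not depend on the chart. -/
lemma geodesic_equation_iff (M a : ℝ) {γ : ℝ → Total} {J : Set ℝ} {s : ℝ} (hJ : J ∈ 𝓝 s)
    (hγ : ContMDiffAt 𝓘(ℝ, ℝ) model 2 γ s) (hρ : ambRho a (incl (γ s)) ≠ 0) :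
    (∀ w : Mod, let c : ℝ → Mod := fun τ => extChartAt model (γ s) (γ τ)
      chartMetric (metric M a) (γ s) (c s) (derivWithin (derivWithin c J) J s) w
      + christoffel (metric M a) (γ s) (c s) (derivWithin c J s) (derivWithin c J s) w = 0) ↔
    AmbientEquation M a (fun τ => incl (γ τ)) s := by
  refine Iff.trans ?_ (chart_equation_iff_ambientEquation M a hγ (mem_extChartAt_source _) hρ)
  have h1 : ∀ c : ℝ → Mod, derivWithin c J s = deriv c s := fun c => derivWithin_of_mem_nhds hJ
  have h2 : ∀ c : ℝ → Mod, deriv (derivWithin c J) s = deriv (deriv c) s := by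
    intro c
    refine EventuallyEq.deriv_eq ?_
    filter_upwards [eventually_mem_nhds_iff.2 hJ] with τ hτ
    exact derivWithin_of_mem_nhds hτ
  simp only [h1, h2]

/-- For nonzero `a` the zero set of ρ² is exactly the ring, so membership in `K^*` is the condition
under which the metric formula is smooth. -/
lemma rhoSq_eq_zero_iff {a : ℝ} (ha : a ≠ 0) (p : Total) :
    ambRho a (incl p) = 0 ↔ p ∉ Kstar := by
  have : p ∉ Kstar ↔ (incl p).2.1 = 0 ∧ (incl p).2.2 2 = 0 := by
    simp only [Kstar, mem_compl_iff, not_not]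
    rfl
  rw [this, ambRho]
  constructor
  · intro h
    have h1 : (incl p).2.1 ^ 2 = 0 := by
      nlinarith [sq_nonneg (incl p).2.1, sq_nonneg (a * (incl p).2.2 2)]
    have h2 : (a * (incl p).2.2 2) ^ 2 = 0 := by
      nlinarith [sq_nonneg (incl p).2.1, sq_nonneg (a * (incl p).2.2 2)]
    refine ⟨pow_eq_zero_iff two_ne_zero |>.1 h1, ?_⟩
    exact (mul_eq_zero.1 (pow_eq_zero_iff two_ne_zero |>.1 h2)).resolve_left ha
  · rintro ⟨h1, h2⟩
    rw [h1, h2]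
    ring

lemma ray_mem_nhds {α : ℝ} {β : EReal} {s : ℝ} (h1 : α < s) (h2 : (s : EReal) < β) :
    ray α β ∈ 𝓝 s := by
  have : IsOpen {τ : ℝ | α < τ ∧ (τ : EReal) < β} :=
    isOpen_Ioi.inter (isOpen_Iio.preimage continuous_coe_real_ereal)
  exact mem_of_superset (this.mem_nhds ⟨h1, h2⟩) fun τ hτ => ⟨hτ.1.le, hτ.2⟩

section Geodesic

variable {M a α : ℝ} {β : EReal} {γ : ℝ → Total}

lemma contMDiffAt_geodesic (hγ : IsGeodesicOn (metric M a) Kstar γ (ray α β)) {s : ℝ}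
    (h1 : α < s) (h2 : (s : EReal) < β) : ContMDiffAt 𝓘(ℝ, ℝ) model 2 γ s :=
  (hγ.contMDiffOn s ⟨h1.le, h2⟩).contMDiffAt (ray_mem_nhds h1 h2)

lemma contDiffAt_geodesic (hγ : IsGeodesicOn (metric M a) Kstar γ (ray α β)) {s : ℝ}
    (h1 : α < s) (h2 : (s : EReal) < β) : ContDiffAt ℝ 2 (fun τ => incl (γ τ)) s :=
  (((contMDiff_infty.1 contMDiff_incl 2).contMDiffAt).comp s
    (contMDiffAt_geodesic hγ h1 h2)).contDiffAt

lemma rho_ne_zero_geodesic (ha : a ≠ 0) (hγ : IsGeodesicOn (metric M a) Kstar γ (ray α β)) {s : ℝ}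
    (h1 : α ≤ s) (h2 : (s : EReal) < β) : ambRho a (incl (γ s)) ≠ 0 := fun h =>
  (rhoSq_eq_zero_iff ha _).1 h (hγ.mapsTo ⟨h1, h2⟩)

lemma ambientEquation_geodesic (ha : a ≠ 0)
    (hγ : IsGeodesicOn (metric M a) Kstar γ (ray α β)) {s : ℝ}
    (h1 : α < s) (h2 : (s : EReal) < β) : AmbientEquation M a (fun τ => incl (γ τ)) s :=
  (geodesic_equation_iff M a (ray_mem_nhds h1 h2) (contMDiffAt_geodesic hγ h1 h2)
    (rho_ne_zero_geodesic ha hγ h1.le h2)).1 (hγ.equation s ⟨h1.le, h2⟩)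

lemma deriv_incl_eq (hγ : IsGeodesicOn (metric M a) Kstar γ (ray α β)) {s : ℝ}
    (h1 : α < s) (h2 : (s : EReal) < β) :
    deriv (fun τ => incl (γ τ)) s
      = mfderiv model 𝓘(ℝ, Amb) incl (γ s) (velocity model γ (ray α β) s) := by
  rw [velocity, mfderivWithin_of_mem_nhds (ray_mem_nhds h1 h2), ← fderiv_apply_one_eq_deriv,
    ← mfderiv_eq_fderiv]
  have h := mfderiv_comp s (contMDiff_incl.mdifferentiable (by simp) (γ s))
    ((contMDiffAt_geodesic hγ h1 h2).mdifferentiableAt (by simp))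
  exact DFunLike.congr_fun h (1 : ℝ)

lemma null_geodesic (hγ : IsNullGeodesicOn (metric M a) Kstar γ (ray α β)) {s : ℝ}
    (h1 : α < s) (h2 : (s : EReal) < β) :
    ambMetric M a (incl (γ s)) (deriv (fun τ => incl (γ τ)) s)
      (deriv (fun τ => incl (γ τ)) s) = 0 := by
  rw [deriv_incl_eq hγ.toIsGeodesicOn h1 h2, ← metric_eq]
  exact hγ.null s ⟨h1.le, h2⟩

lemma deriv_ne_zero_geodesic (hγ : IsNullGeodesicOn (metric M a) Kstar γ (ray α β)) {s : ℝ}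
    (h1 : α < s) (h2 : (s : EReal) < β) : deriv (fun τ => incl (γ τ)) s ≠ 0 := by
  rw [deriv_incl_eq hγ.toIsGeodesicOn h1 h2]
  intro h
  exact hγ.velocity_ne_zero s ⟨h1.le, h2⟩ (mfderiv_incl_injective _ (h.trans (map_zero _).symm))

end Geodesic

end Kerr

/-! ### Continuation of solutions of differential equations. -/

namespace PseudoRiemannian

section ODE

variable {F : Type*} [NormedAddCommGroup F] [NormedSpace ℝ F] [CompleteSpace F]

/-- A curve of bounded velocity on a bounded interval has a limit at the end of the interval. -/
lemma exists_tendsto_of_bounded_deriv {f f' : ℝ → F} {s₀ b N : ℝ} (hsb : s₀ < b)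
    (hf : ∀ s ∈ Ioo s₀ b, HasDerivAt f (f' s) s) (hN : ∀ s ∈ Ioo s₀ b, ‖f' s‖ ≤ N) :
    ∃ l, Tendsto f (𝓝[<] b) (𝓝 l) := by
  have hl : LipschitzOnWith N.toNNReal f (Ioo s₀ b) :=
    (convex_Ioo s₀ b).lipschitzOnWith_of_nnnorm_hasDerivWithin_le
      (fun s hs => (hf s hs).hasDerivWithinAt)
      (fun s hs => by
        rw [← NNReal.coe_le_coe, coe_nnnorm]
        exact (hN s hs).trans (Real.le_coe_toNNReal N))
  have hle : 𝓝[<] b ≤ 𝓟 (Ioo s₀ b) := le_principal_iff.2 (Ioo_mem_nhdsLT hsb)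
  have hc : Cauchy (𝓝[<] b) := cauchy_nhds.mono nhdsWithin_le_nhds
  have := hc.map_of_le hl.uniformContinuousOn hle
  exact cauchy_map_iff_exists_tendsto.1 this

/-- A solution of an autonomous differential equation that converges to a point near which the
vector field is of class `C¹` can be continued. -/
lemma exists_ode_continuation {f : F → F} {Y : ℝ → F} {b : ℝ} {Yb : F}
    (hf : ContDiffAt ℝ 1 f Yb) (hY : ∀ᶠ s in 𝓝[<] b, HasDerivAt Y (f (Y s)) s)
    (hlim : Tendsto Y (𝓝[<] b) (𝓝 Yb)) :
    ∃ Z : ℝ → F, (∀ s < b, Z s = Y s) ∧ Z b = Yb ∧ ∀ᶠ s in 𝓝 b, HasDerivAt Z (f (Z s)) s := by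
  -- Only the part of the local solution `y` to the right of `b` is used: it is glued to `Y`, so no
  -- uniqueness theorem is needed.
  obtain ⟨y, hyb, ε, hε, hy⟩ :=
    hf.exists_forall_mem_closedBall_exists_eq_forall_mem_Ioo_hasDerivAt₀ b
  set Z : ℝ → F := fun s => if s < b then Y s else y s with hZ
  have hZl : ∀ s < b, Z s = Y s := fun s hs => if_pos hs
  have hZr : ∀ s, b ≤ s → Z s = y s := fun s hs => if_neg hs.not_gt
  have hl : ∀ᶠ s in 𝓝[<] b, HasDerivAt Z (f (Z s)) s := by
    filter_upwards [hY, self_mem_nhdsWithin] with s hs hsb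
    have he : Z =ᶠ[𝓝 s] Y := by
      filter_upwards [Iio_mem_nhds hsb] with τ hτ using hZl τ hτ
    rw [hZl s hsb]
    exact hs.congr_of_eventuallyEq he
  have hr : ∀ᶠ s in 𝓝[>] b, HasDerivAt Z (f (Z s)) s := by
    filter_upwards [Ioo_mem_nhdsGT (show b < b + ε by linarith)] with s hs
    have he : Z =ᶠ[𝓝 s] y := by
      filter_upwards [Ioi_mem_nhds hs.1] with τ hτ using hZr τ (le_of_lt hτ)
    rw [hZr s hs.1.le]
    exact (hy s ⟨by linarith [hs.1], hs.2⟩).congr_of_eventuallyEq he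
  have hb : HasDerivAt Z (f (Z b)) b := by
    have hZb : Z b = Yb := (hZr b le_rfl).trans hyb
    have hZlim : Tendsto Z (𝓝[<] b) (𝓝 Yb) :=
      hlim.congr' (by filter_upwards [self_mem_nhdsWithin] with s hs using (hZl s hs).symm)
    obtain ⟨s₀, hs₀, hs₀'⟩ := (mem_nhdsLT_iff_exists_Ioo_subset).1 hl
    -- The left derivative at `b` exists because `Z` is continuous there and its derivative `f (Z
    -- s)` converges.
    have h1 : HasDerivWithinAt Z (f (Z b)) (Iic b) b := by
      refine hasDerivWithinAt_Iic_of_tendsto_deriv (s := Ioo s₀ b)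
        (fun s hs => (hs₀' hs).differentiableAt.differentiableWithinAt) ?_
        (Ioo_mem_nhdsLT hs₀) ?_
      · rw [ContinuousWithinAt, hZb]
        exact hZlim.mono_left (nhdsWithin_mono _ Ioo_subset_Iio_self)
      · rw [hZb]
        refine (hf.continuousAt.tendsto.comp hZlim).congr' ?_
        filter_upwards [hl] with s hs using hs.deriv.symm
    have h2 : HasDerivWithinAt Z (f (Z b)) (Ici b) b := by
      rw [hZr b le_rfl]
      exact (hy b ⟨by linarith, by linarith⟩).hasDerivWithinAt.congr (fun s hs => hZr s hs)
        (hZr b le_rfl)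
    have := h1.union h2
    rwa [Iic_union_Ici, hasDerivWithinAt_univ] at this
  refine ⟨Z, hZl, (hZr b le_rfl).trans hyb, ?_⟩
  rw [← nhdsNE_sup_pure, ← nhdsLT_sup_nhdsGT]
  exact eventually_sup.2 ⟨eventually_sup.2 ⟨hl, hr⟩, hb⟩

end ODE

/-! ### The geodesic equation solved for the second derivative. -/

section Acceleration

variable {E V : Type*} [NormedAddCommGroup E] [NormedSpace ℝ E]
  [NormedAddCommGroup V] [NormedSpace ℝ V]

/-- The pullback of the metric `G` by `ψ`, as a map to the dual space. -/
def lowered (G : V → V →L[ℝ] V →L[ℝ] ℝ) (ψ : E → V) (y : E) : E →L[ℝ] E →L[ℝ] ℝ :=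
  ((((ContinuousLinearMap.compL ℝ E V ℝ).flip (fderiv ℝ ψ y)).comp (G (ψ y))).comp
    (fderiv ℝ ψ y))

lemma lowered_apply (G : V → V →L[ℝ] V →L[ℝ] ℝ) (ψ : E → V) (y u w : E) :
    lowered G ψ y u w = G (ψ y) (fderiv ℝ ψ y u) (fderiv ℝ ψ y w) := rfl

/-- The covector `eulerLagrange G X X₁ X₂`. -/
def eulerLagrangeCovector (G : V → V →L[ℝ] V →L[ℝ] ℝ) (X X₁ X₂ : V) : V →L[ℝ] ℝ :=
  G X X₂ + fderiv ℝ G X X₁ X₁ - (1 / 2 : ℝ) • ((ContinuousLinearMap.apply ℝ ℝ X₁).comp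
    ((ContinuousLinearMap.apply ℝ (V →L[ℝ] ℝ) X₁).comp (fderiv ℝ G X)))

lemma eulerLagrangeCovector_apply (G : V → V →L[ℝ] V →L[ℝ] ℝ) (X X₁ X₂ W : V) :
    eulerLagrangeCovector G X X₁ X₂ W = eulerLagrange G X X₁ X₂ W := by
  simp [eulerLagrangeCovector, eulerLagrange]
  ring

/-- The force term in the geodesic equation of the pullback of `G` by `ψ`. -/
def force (G : V → V →L[ℝ] V →L[ℝ] ℝ) (ψ : E → V) (x : E × E) : E →L[ℝ] ℝ :=
  (eulerLagrangeCovector G (ψ x.1) (fderiv ℝ ψ x.1 x.2)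
    (fderiv ℝ (fderiv ℝ ψ) x.1 x.2 x.2)).comp (fderiv ℝ ψ x.1)

/-- The acceleration of a geodesic of the pullback of `G` by `ψ`. -/
def acceleration (G : V → V →L[ℝ] V →L[ℝ] ℝ) (ψ : E → V) (x : E × E) : E :=
  -(lowered G ψ x.1).inverse (force G ψ x)

/-- The equation is affine in `c₂`, with linear part the lowered metric; inverting this raises the
index. -/
lemma eq_acceleration_iff {G : V → V →L[ℝ] V →L[ℝ] ℝ} {ψ : E → V} {y : E}
    (hi : (lowered G ψ y).IsInvertible) (v c₂ : E) :
    (∀ w, eulerLagrange G (ψ y) (fderiv ℝ ψ y v)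
        (fderiv ℝ (fderiv ℝ ψ) y v v + fderiv ℝ ψ y c₂) (fderiv ℝ ψ y w) = 0)
      ↔ c₂ = acceleration G ψ (y, v) := by
  have h1 : ∀ w, eulerLagrange G (ψ y) (fderiv ℝ ψ y v)
        (fderiv ℝ (fderiv ℝ ψ) y v v + fderiv ℝ ψ y c₂) (fderiv ℝ ψ y w)
      = (lowered G ψ y c₂ + force G ψ (y, v)) w := by
    intro w
    rw [add_apply, lowered_apply, force, ContinuousLinearMap.comp_apply,
      eulerLagrangeCovector_apply]
    simp only [eulerLagrange, map_add, add_apply]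
    ring
  simp only [h1]
  obtain ⟨e, he⟩ := hi
  rw [acceleration, ← he, ContinuousLinearMap.inverse_equiv]
  constructor
  · intro h
    have h2 : e c₂ = -force G ψ (y, v) := eq_neg_of_add_eq_zero_left (by
      ext w
      exact h w)
    rw [eq_comm, ← map_neg, ← h2]
    exact e.symm_apply_apply c₂
  · rintro rfl w
    simp

set_option maxSynthPendingDepth 3 in
lemma contDiffAt_acceleration [CompleteSpace E] {G : V → V →L[ℝ] V →L[ℝ] ℝ} {ψ : E → V} {y : E}
    (hi : (lowered G ψ y).IsInvertible) (hG : ContDiffAt ℝ 2 G (ψ y)) (hψ : ContDiff ℝ 3 ψ) (v : E) :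
    ContDiffAt ℝ 1 (acceleration G ψ) (y, v) := by
  have hG0 : ContDiffAt ℝ 1 G (ψ y) := hG.of_le (by norm_num)
  have hG1 : ContDiffAt ℝ 1 (fderiv ℝ G) (ψ y) := hG.fderiv_right (by norm_num)
  have h1 : ContDiffAt ℝ 1 (fun x : E × E => x.1) (y, v) := contDiffAt_fst
  have h2 : ContDiffAt ℝ 1 (fun x : E × E => x.2) (y, v) := contDiffAt_snd
  have hψ0 : ContDiffAt ℝ 1 (fun x : E × E => ψ x.1) (y, v) :=
    (hψ.of_le (by norm_num)).contDiffAt.comp (y, v) h1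
  have hψ1 : ContDiff ℝ 2 (fderiv ℝ ψ) := hψ.fderiv_right (by norm_num)
  have hψ2 : ContDiff ℝ 1 (fderiv ℝ (fderiv ℝ ψ)) := hψ1.fderiv_right (by norm_num)
  have hD : ContDiffAt ℝ 1 (fun x : E × E => fderiv ℝ ψ x.1) (y, v) :=
    (hψ1.of_le (by norm_num)).contDiffAt.comp (y, v) h1
  have hDD : ContDiffAt ℝ 1 (fun x : E × E => fderiv ℝ (fderiv ℝ ψ) x.1) (y, v) :=
    hψ2.contDiffAt.comp (y, v) h1
  have hGc : ContDiffAt ℝ 1 (fun x : E × E => G (ψ x.1)) (y, v) := hG0.comp (y, v) hψ0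
  have hGd : ContDiffAt ℝ 1 (fun x : E × E => fderiv ℝ G (ψ x.1)) (y, v) := hG1.comp (y, v) hψ0
  have hX1 : ContDiffAt ℝ 1 (fun x : E × E => fderiv ℝ ψ x.1 x.2) (y, v) := hD.clm_apply h2
  have hl : ContDiffAt ℝ 1 (fun x : E × E => lowered G ψ x.1) (y, v) :=
    ((((ContinuousLinearMap.compL ℝ E V ℝ).flip.contDiff.contDiffAt.comp (y, v) hD).clm_comp
      hGc).clm_comp hD)
  have ha : ContDiffAt ℝ 1
      (fun x : E × E => ContinuousLinearMap.apply ℝ ℝ (fderiv ℝ ψ x.1 x.2)) (y, v) :=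
    (ContinuousLinearMap.apply ℝ ℝ).contDiff.contDiffAt.comp (y, v) hX1
  have ha' : ContDiffAt ℝ 1
      (fun x : E × E => ContinuousLinearMap.apply ℝ (V →L[ℝ] ℝ) (fderiv ℝ ψ x.1 x.2)) (y, v) :=
    (ContinuousLinearMap.apply ℝ (V →L[ℝ] ℝ)).contDiff.contDiffAt.comp (y, v) hX1
  have hf : ContDiffAt ℝ 1 (force G ψ) (y, v) := by
    unfold force eulerLagrangeCovector
    exact (((hGc.clm_apply ((hDD.clm_apply h2).clm_apply h2)).add
      ((hGd.clm_apply hX1).clm_apply hX1)).sub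
      ((ha.clm_comp (ha'.clm_comp hGd)).const_smul (1 / 2 : ℝ))).clm_comp hD
  have hinv : ContDiffAt ℝ 1 (fun x : E × E => (lowered G ψ x.1).inverse) (y, v) :=
    ContDiffAt.comp (y, v) (g := ContinuousLinearMap.inverse)
      (hi.contDiffAt_map_inverse) hl
  exact (hinv.clm_apply hf).neg

/-- Nondegeneracy is injectivity into the dual space, which has the same finite dimension. -/
lemma isInvertible_lowered [FiniteDimensional ℝ E] {G : V → V →L[ℝ] V →L[ℝ] ℝ} {ψ : E → V} {y : E}
    (h : ∀ u, (∀ w, G (ψ y) (fderiv ℝ ψ y u) (fderiv ℝ ψ y w) = 0) → u = 0) :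
    (lowered G ψ y).IsInvertible := by
  have hinj : Function.Injective (lowered G ψ y : E →ₗ[ℝ] E →L[ℝ] ℝ) := by
    rw [injective_iff_map_eq_zero]
    intro u hu
    exact h u fun w => DFunLike.congr_fun hu w
  have hfin : Module.finrank ℝ E = Module.finrank ℝ (E →L[ℝ] ℝ) := by
    rw [← (LinearMap.toContinuousLinearMap : (E →ₗ[ℝ] ℝ) ≃ₗ[ℝ] E →L[ℝ] ℝ).finrank_eq]
    exact (Subspace.dual_finrank_eq (K := ℝ) (V := E)).symm
  exact ⟨(LinearMap.linearEquivOfInjective _ hinj hfin).toContinuousLinearEquiv, rfl⟩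

end Acceleration

end PseudoRiemannian

/-! ### Extension of geodesics with bounded velocity. -/

namespace Kerr

open PseudoRiemannian

lemma contDiffOn_two_of_hasDerivAt {F : Type*} [NormedAddCommGroup F] [NormedSpace ℝ F]
    {f f' f'' : ℝ → F} {s : Set ℝ} (hs : IsOpen s) (h1 : ∀ x ∈ s, HasDerivAt f (f' x) x)
    (h2 : ∀ x ∈ s, HasDerivAt f' (f'' x) x) (h3 : ContinuousOn f'' s) : ContDiffOn ℝ 2 f s := by
  have key : ∀ {g g' : ℝ → F} {n : WithTop ℕ∞}, n ≠ ω → (∀ x ∈ s, HasDerivAt g (g' x) x) →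
      ContDiffOn ℝ n g' s → ContDiffOn ℝ (n + 1) g s := by
    intro g g' n hn hg hg'
    rw [contDiffOn_succ_iff_deriv_of_isOpen hs]
    exact ⟨fun x hx => (hg x hx).differentiableAt.differentiableWithinAt, fun h => absurd h hn,
      hg'.congr fun x hx => (hg x hx).deriv⟩
  have h := key (by simp) h1 (key (by simp) h2 (contDiffOn_zero.2 h3))
  rwa [show (0 + 1 + 1 : WithTop ℕ∞) = 2 by norm_num] at h

/-- An injective linear map from a finite-dimensional space is bounded below, and a small
perturbation loses at most half of the bound, hence the factor 2. It converts bounds on ambient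
velocities into bounds on velocities in a chart. -/
lemma eventually_norm_le_of_injective {E V : Type*} [NormedAddCommGroup E] [NormedSpace ℝ E]
    [NormedAddCommGroup V] [NormedSpace ℝ V] [FiniteDimensional ℝ E] {A : E → E →L[ℝ] V} {y₀ : E}
    (hA : ContinuousAt A y₀) (hi : Function.Injective (A y₀)) :
    ∃ k : ℝ, ∀ᶠ y in 𝓝 y₀, ∀ v, ‖v‖ ≤ k * ‖A y v‖ := by
  obtain ⟨K, hK, hKA⟩ := LinearMap.exists_antilipschitzWith (A y₀ : E →ₗ[ℝ] V)
    (LinearMap.ker_eq_bot.2 hi)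
  have hK' : (0 : ℝ) < K := hK
  refine ⟨2 * K, ?_⟩
  filter_upwards [Metric.continuousAt_iff'.1 hA (1 / (2 * K)) (by positivity)] with y hy v
  have h1 : ‖v‖ ≤ K * ‖A y₀ v‖ := by
    simpa using hKA.le_mul_dist v 0
  have h2 : ‖A y₀ v - A y v‖ ≤ 1 / (2 * K) * ‖v‖ := by
    rw [← sub_apply]
    refine ((A y₀ - A y).le_opNorm v).trans ?_
    rw [← dist_eq_norm, dist_comm]
    gcongr
  have h3 : ‖A y₀ v‖ ≤ ‖A y v‖ + 1 / (2 * K) * ‖v‖ := by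
    have := norm_sub_norm_le (A y₀ v) (A y v)
    linarith
  have h4 : K * ‖A y₀ v‖ ≤ K * ‖A y v‖ + ‖v‖ / 2 := by
    calc (K : ℝ) * ‖A y₀ v‖ ≤ K * (‖A y v‖ + 1 / (2 * K) * ‖v‖) := by gcongr
      _ = _ := by field_simp
  linarith

lemma isInducing_incl : IsInducing incl :=
  IsInducing.id.prodMap (IsInducing.id.prodMap IsInducing.subtypeVal)

lemma isInvertible_lowered_param (M a : ℝ) (p : Total) {y : Mod}
    (hρ : ambRho a (param p y) ≠ 0) :
    (lowered (ambMetric M a) (param p) y).IsInvertible := by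
  refine isInvertible_lowered fun u hu => fderiv_param_injective p y ?_
  rw [map_zero]
  refine ambMetric_nondegenerate M a hρ ((mem_range_fderiv_param p y _).1 ⟨u, rfl⟩) fun W hW => ?_
  obtain ⟨w, rfl⟩ := (mem_range_fderiv_param p y W).2 hW
  exact hu w

lemma contDiffAt_acceleration_param (M a : ℝ) (p : Total) {x : Mod × Mod}
    (hρ : ambRho a (param p x.1) ≠ 0) :
    ContDiffAt ℝ 1 (acceleration (ambMetric M a) (param p)) x :=
  contDiffAt_acceleration (isInvertible_lowered_param M a p hρ) (contDiffAt_ambMetric M a hρ)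
    (contDiff_infty.1 (contDiff_param p) 3) x.2

lemma ambientEquation_param_iff (M a : ℝ) (p : Total) {c : ℝ → Mod} {s : ℝ}
    (hc : ContDiffAt ℝ 2 c s) (hρ : ambRho a (param p (c s)) ≠ 0) :
    AmbientEquation M a (fun τ => param p (c τ)) s ↔
      deriv (deriv c) s = acceleration (ambMetric M a) (param p) (c s, deriv c s) := by
  have hψ : ContDiff ℝ 2 (param p) := contDiff_infty.1 (contDiff_param p) 2
  rw [← eq_acceleration_iff (isInvertible_lowered_param M a p hρ), AmbientEquation,
    deriv_comp_param hψ hc, deriv_deriv_comp_param hψ hc]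
  simp only [← mem_range_fderiv_param]
  constructor
  · exact fun h w => h _ ⟨w, rfl⟩
  · rintro h W ⟨w, rfl⟩
    exact h w

lemma continuous_ambRho (a : ℝ) : Continuous (ambRho a) :=
  (dr.continuous.pow 2).add (continuous_const.mul ((dn 2).continuous.pow 2))

lemma eventually_lt_ray {α b : ℝ} (hαb : α < b) :
    ∀ᶠ s in 𝓝[<] b, α < s ∧ ((s : ℝ) : EReal) < (b : EReal) := by
  filter_upwards [Ioo_mem_nhdsLT hαb] with s hs using ⟨hs.1, EReal.coe_lt_coe_iff.2 hs.2⟩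

/-- A geodesic that stays in a compact set and has bounded velocity converges. -/
lemma exists_limit_of_bounded_velocity {M a α b s₀ N : ℝ} {γ : ℝ → Total} (hα : α ≤ s₀)
    (hb : s₀ < b) (hγ : IsGeodesicOn (metric M a) Kstar γ (ray α b)) {C : Set Total}
    (hC : IsCompact C) (hγC : γ '' ray α b ⊆ C)
    (hN : ∀ s ∈ Ioo s₀ b, ‖deriv (fun τ => incl (γ τ)) s‖ ≤ N) :
    ∃ p ∈ C, Tendsto γ (𝓝[<] b) (𝓝 p) := by
  obtain ⟨l, hl⟩ := exists_tendsto_of_bounded_deriv hb (fun s hs =>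
    ((contDiffAt_geodesic hγ (hα.trans_lt hs.1) (EReal.coe_lt_coe_iff.2 hs.2)).differentiableAt
      (by simp)).hasDerivAt) hN
  have hcl : IsClosed (incl '' C) := (hC.image isInducing_incl.continuous).isClosed
  have hmem : l ∈ incl '' C := hcl.mem_of_tendsto hl (by
    filter_upwards [eventually_lt_ray (hα.trans_lt hb)] with s hs
    exact ⟨_, hγC ⟨s, ⟨hs.1.le, hs.2⟩, rfl⟩, rfl⟩)
  obtain ⟨p, hp, rfl⟩ := hmem
  exact ⟨p, hp, isInducing_incl.tendsto_nhds_iff.2 hl⟩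

/-- In the chart at its limit point, a geodesic of bounded velocity is a solution of a first order
equation, and converges together with its velocity. -/
lemma chart_solution_of_tendsto {M a α b N : ℝ} (ha : a ≠ 0) {γ : ℝ → Total} (hαb : α < b)
    (hγ : IsGeodesicOn (metric M a) Kstar γ (ray α b)) {p : Total} (hp : p ∈ Kstar)
    (hlim : Tendsto γ (𝓝[<] b) (𝓝 p))
    (hN : ∀ᶠ s in 𝓝[<] b, ‖deriv (fun τ => incl (γ τ)) s‖ ≤ N) :
    ∃ v : Mod, ∃ Y : ℝ → Mod × Mod, Tendsto Y (𝓝[<] b) (𝓝 (extChartAt model p p, v)) ∧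
      (∀ᶠ s in 𝓝[<] b,
        HasDerivAt Y ((Y s).2, acceleration (ambMetric M a) (param p) (Y s)) s) ∧
      ∀ᶠ s in 𝓝[<] b, γ s = (extChartAt model p).symm (Y s).1 := by
  set c : ℝ → Mod := fun τ => extChartAt model p (γ τ) with hc
  set y₀ : Mod := extChartAt model p p with hy₀
  have hψ : ContDiff ℝ 2 (param p) := contDiff_infty.1 (contDiff_param p) 2
  have hρ₀ : ambRho a (param p y₀) ≠ 0 := by
    rw [hy₀, param_extChartAt p p (mem_extChartAt_source p)]
    exact fun h => (rhoSq_eq_zero_iff ha _).1 h hp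
  have hclim : Tendsto c (𝓝[<] b) (𝓝 y₀) := (continuousAt_extChartAt p).tendsto.comp hlim
  have hsrc : ∀ᶠ s in 𝓝[<] b, γ s ∈ (extChartAt model p).source :=
    hlim.eventually (extChartAt_source_mem_nhds p)
  have hray := eventually_lt_ray hαb
  have hc2 : ∀ᶠ s in 𝓝[<] b, ContDiffAt ℝ 2 c s := by
    filter_upwards [hsrc, hray] with s h1 h2
    exact contDiffAt_extChartAt_comp (contMDiffAt_geodesic hγ h2.1 h2.2) h1
  have hρU : ∀ᶠ y in 𝓝 y₀, ambRho a (param p y) ≠ 0 :=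
    ((continuous_ambRho a).comp hψ.continuous).continuousAt.eventually_ne hρ₀
  have hacc : ∀ᶠ s in 𝓝[<] b,
      deriv (deriv c) s = acceleration (ambMetric M a) (param p) (c s, deriv c s) := by
    filter_upwards [hsrc, hray, hc2, hclim.eventually hρU] with s h1 h2 h3 h4
    rw [← ambientEquation_param_iff M a p h3 h4]
    exact (ambientEquation_geodesic ha hγ h2.1 h2.2).congr
      (param_extChartAt_eventuallyEq (contMDiffAt_geodesic hγ h2.1 h2.2).continuousAt h1).symm
  obtain ⟨k, hk⟩ := eventually_norm_le_of_injective
    (hψ.continuous_fderiv (by simp)).continuousAt (fderiv_param_injective p y₀)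
  have hvel : ∀ᶠ s in 𝓝[<] b, ‖deriv c s‖ ≤ |k| * N := by
    filter_upwards [hsrc, hray, hc2, hclim.eventually hk, hN] with s h1 h2 h3 h4 h5
    refine (h4 (deriv c s)).trans ?_
    rw [← deriv_comp_param hψ h3, (param_extChartAt_eventuallyEq
      (contMDiffAt_geodesic hγ h2.1 h2.2).continuousAt h1).deriv_eq]
    gcongr
    exact le_abs_self k
  obtain ⟨δ, hδ, hδU⟩ := Metric.nhds_basis_closedBall.mem_iff.1 hρU
  -- Position and velocity in the chart remain in a compact set on which the acceleration is
  -- continuous. Bounded acceleration makes the velocity converge as well.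
  obtain ⟨B, hB⟩ := ((isCompact_closedBall y₀ δ).prod
      (isCompact_closedBall (0 : Mod) (|k| * N))).exists_bound_of_continuousOn
    (f := acceleration (ambMetric M a) (param p))
    fun x hx => (contDiffAt_acceleration_param M a p (hδU hx.1)).continuousAt.continuousWithinAt
  have hd1 : ∀ᶠ s in 𝓝[<] b, HasDerivAt c (deriv c s) s := by
    filter_upwards [hc2] with s hs using (hs.differentiableAt (by simp)).hasDerivAt
  have hd2 : ∀ᶠ s in 𝓝[<] b, HasDerivAt (deriv c)
      (acceleration (ambMetric M a) (param p) (c s, deriv c s)) s := by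
    filter_upwards [hc2, hacc] with s hs h2
    rw [← h2]
    exact (differentiableAt_deriv hs).hasDerivAt
  have hbd : ∀ᶠ s in 𝓝[<] b, ‖acceleration (ambMetric M a) (param p) (c s, deriv c s)‖ ≤ B := by
    filter_upwards [hvel, hclim.eventually (Metric.closedBall_mem_nhds y₀ hδ)] with s h1 h2
    exact hB _ ⟨h2, by simpa using h1⟩
  obtain ⟨s₁, hs₁, hs₁'⟩ := (mem_nhdsLT_iff_exists_Ioo_subset).1 (hd2.and hbd)
  obtain ⟨v, hv⟩ := exists_tendsto_of_bounded_deriv hs₁ (fun s hs => (hs₁' hs).1)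
    fun s hs => (hs₁' hs).2
  refine ⟨v, fun s => (c s, deriv c s), hclim.prodMk_nhds hv, ?_, ?_⟩
  · filter_upwards [hd1, hd2] with s h1 h2 using h1.prodMk h2
  · filter_upwards [hsrc] with s hs using ((extChartAt model p).left_inv hs).symm

end Kerr

namespace PseudoRiemannian

variable {E : Type*} [NormedAddCommGroup E] [NormedSpace ℝ E]
  {H : Type*} [TopologicalSpace H] {I : ModelWithCorners ℝ E H}
  {M : Type*} [TopologicalSpace M] [ChartedSpace H M]

/-- The geodesic equation at a parameter depends only on the curve near this parameter. -/
lemma geodesic_equation_congr (g : BilinearField I (M := M)) {γ γ' : ℝ → M} {J J' U : Set ℝ}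
    (hU : IsOpen U) (hJ : J' ∩ U = J) (hγ : EqOn γ' γ J) {s : ℝ} (hs : s ∈ J) (w : E)
    (h : let c : ℝ → E := fun τ => extChartAt I (γ s) (γ τ)
      chartMetric g (γ s) (c s) (derivWithin (derivWithin c J) J s) w
        + christoffel g (γ s) (c s) (derivWithin c J s) (derivWithin c J s) w = 0) :
    let c : ℝ → E := fun τ => extChartAt I (γ' s) (γ' τ)
    chartMetric g (γ' s) (c s) (derivWithin (derivWithin c J') J' s) w
      + christoffel g (γ' s) (c s) (derivWithin c J' s) (derivWithin c J' s) w = 0 := by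
  have hsub : J ⊆ U := hJ ▸ inter_subset_right
  have hd : ∀ f : ℝ → E, ∀ τ ∈ J, derivWithin f J' τ = derivWithin f J τ := fun f τ hτ => by
    rw [← hJ, derivWithin_inter (hU.mem_nhds (hsub hτ))]
  have h1 : ∀ τ ∈ J, derivWithin (fun τ => extChartAt I (γ s) (γ' τ)) J' τ
      = derivWithin (fun τ => extChartAt I (γ s) (γ τ)) J τ := fun τ hτ => by
    rw [hd _ _ hτ]
    exact derivWithin_congr (fun x hx => by simp only [hγ hx]) (by simp only [hγ hτ])
  have h2 : derivWithin (derivWithin (fun τ => extChartAt I (γ s) (γ' τ)) J') J' s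
      = derivWithin (derivWithin (fun τ => extChartAt I (γ s) (γ τ)) J) J s := by
    rw [hd _ _ hs]
    exact derivWithin_congr h1 (h1 s hs)
  simp only [hγ hs, h1 s hs, h2]
  exact h

end PseudoRiemannian

namespace Kerr

open PseudoRiemannian

lemma ray_inter_Iio {α b b' : ℝ} (hb : b ≤ b') :
    ray α (b' : EReal) ∩ Iio b = ray α (b : EReal) := by
  ext s
  simp only [ray, mem_inter_iff, mem_ofPred_eq, mem_Iio, EReal.coe_lt_coe_iff]
  constructor
  · exact fun h => ⟨h.1.1, h.2⟩
  · exact fun h => ⟨⟨h.1, h.2.trans_le hb⟩, h.2⟩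

/-- A geodesic of bounded velocity on a bounded interval that stays in a compact set is, near the
end of the interval, the restriction of a solution of the geodesic equation in a chart. -/
lemma exists_chart_continuation {M a α b s₀ N : ℝ} (ha : a ≠ 0) {γ : ℝ → Total}
    (hα : α ≤ s₀) (hb : s₀ < b) (hγ : IsGeodesicOn (metric M a) Kstar γ (ray α b)) {C : Set Total}
    (hC : IsCompact C) (hCK : C ⊆ Kstar) (hγC : γ '' ray α b ⊆ C)
    (hN : ∀ s ∈ Ioo s₀ b, ‖deriv (fun τ => incl (γ τ)) s‖ ≤ N) :
    ∃ p : Total, ∃ c : ℝ → Mod, ∃ δ > 0, (∀ s ∈ Ioo (b - δ) (b + δ), ContDiffAt ℝ 2 c s ∧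
      ambRho a (param p (c s)) ≠ 0 ∧ AmbientEquation M a (fun τ => param p (c τ)) s ∧
      (s < b → γ s = (extChartAt model p).symm (c s))) := by
  obtain ⟨p, hpC, hlim⟩ := exists_limit_of_bounded_velocity hα hb hγ hC hγC hN
  obtain ⟨v, Y, hYlim, hY, hYγ⟩ := chart_solution_of_tendsto ha (hα.trans_lt hb) hγ (hCK hpC) hlim
    (by filter_upwards [Ioo_mem_nhdsLT hb] with s hs using hN s hs)
  have hψ : ContDiff ℝ 2 (param p) := contDiff_infty.1 (contDiff_param p) 2
  have hρ₀ : ambRho a (param p (extChartAt model p p)) ≠ 0 := by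
    rw [param_extChartAt p p (mem_extChartAt_source p)]
    exact fun h => (rhoSq_eq_zero_iff ha _).1 h (hCK hpC)
  have hf : ContDiffAt ℝ 1 (fun x : Mod × Mod => (x.2, acceleration (ambMetric M a) (param p) x))
      (extChartAt model p p, v) :=
    ContDiffAt.prodMk contDiffAt_snd
      (contDiffAt_acceleration_param M a p (x := (extChartAt model p p, v)) hρ₀)
  obtain ⟨Z, hZl, hZb, hZ⟩ := exists_ode_continuation hf hY hYlim
  have hZρ : ∀ᶠ s in 𝓝 b, ambRho a (param p (Z s).1) ≠ 0 := by
    have hcont : ContinuousAt (fun s => ambRho a (param p (Z s).1)) b :=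
      ((continuous_ambRho a).comp hψ.continuous).continuousAt.comp
        (continuousAt_fst.comp hZ.self_of_nhds.continuousAt)
    refine hcont.eventually_ne ?_
    rwa [hZb]
  have hZγ : ∀ᶠ s in 𝓝 b, s < b → γ s = (extChartAt model p).symm (Z s).1 := by
    refine eventually_nhdsWithin_iff (s := Iio b) |>.1 ?_
    filter_upwards [hYγ, self_mem_nhdsWithin] with s h1 h2
    rw [h1, hZl s h2]
  obtain ⟨δ, hδ, hδb⟩ := (nhds_basis_Ioo_pos b).eventually_iff.1 (hZ.and (hZρ.and hZγ))
  have hd1 : ∀ s ∈ Ioo (b - δ) (b + δ), HasDerivAt (fun s => (Z s).1) (Z s).2 s :=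
    fun s hs => (hδb hs).1.fst
  have hd2 : ∀ s ∈ Ioo (b - δ) (b + δ), HasDerivAt (fun s => (Z s).2)
      (acceleration (ambMetric M a) (param p) (Z s)) s := fun s hs => (hδb hs).1.snd
  have hc2 : ContDiffOn ℝ 2 (fun s => (Z s).1) (Ioo (b - δ) (b + δ)) :=
    contDiffOn_two_of_hasDerivAt isOpen_Ioo hd1 hd2 fun s hs =>
      ((contDiffAt_acceleration_param M a p (hδb hs).2.1).continuousAt.comp
        (hδb hs).1.continuousAt).continuousWithinAt
  refine ⟨p, fun s => (Z s).1, δ, hδ, fun s hs => ?_⟩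
  have hcs := hc2.contDiffAt (isOpen_Ioo.mem_nhds hs)
  refine ⟨hcs, (hδb hs).2.1, ?_, (hδb hs).2.2⟩
  rw [ambientEquation_param_iff M a p hcs (hδb hs).2.1, (hd1 s hs).deriv]
  refine Eq.trans (EventuallyEq.deriv_eq ?_) (hd2 s hs).deriv
  filter_upwards [isOpen_Ioo.mem_nhds hs] with τ hτ using (hd1 τ hτ).deriv

/-- A geodesic of bounded velocity on a bounded interval that stays in a compact set extends. -/
theorem not_isMaximalAtEnd_of_bounded_velocity {M a α b s₀ N : ℝ} (ha : a ≠ 0) {γ : ℝ → Total}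
    (hα : α ≤ s₀) (hb : s₀ < b) (hγ : IsGeodesicOn (metric M a) Kstar γ (ray α b)) {C : Set Total}
    (hC : IsCompact C) (hCK : C ⊆ Kstar) (hγC : γ '' ray α b ⊆ C)
    (hN : ∀ s ∈ Ioo s₀ b, ‖deriv (fun τ => incl (γ τ)) s‖ ≤ N) :
    ¬ IsMaximalAtEnd (metric M a) Kstar γ α b := by
  classical
  obtain ⟨p, c, δ, hδ, hc⟩ := exists_chart_continuation ha hα hb hγ hC hCK hγC hN
  obtain ⟨γ', hγ'l, hγ'J⟩ : ∃ γ' : ℝ → Total, (∀ s < b, γ' s = γ s) ∧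
      ∀ s ∈ Ioo (b - δ) (b + δ), γ' s = (extChartAt model p).symm (c s) := by
    -- The extension is `γ` before `b` and the chart solution afterwards; on `(b - δ, b + δ)` it
    -- agrees with the chart solution on both sides, so it is smooth across `b`.
    refine ⟨fun s => if s < b then γ s else (extChartAt model p).symm (c s),
      fun s hs => if_pos hs, fun s hs => ?_⟩
    by_cases hsb : s < b
    · exact (if_pos hsb).trans ((hc s hs).2.2.2 hsb)
    · exact if_neg hsb
  have hγ'ev : ∀ s ∈ Ioo (b - δ) (b + δ), γ' =ᶠ[𝓝 s] fun τ => (extChartAt model p).symm (c τ) :=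
    fun s hs => by
      filter_upwards [isOpen_Ioo.mem_nhds hs] with τ hτ using hγ'J τ hτ
  have hsm : ∀ s ∈ Ioo (b - δ) (b + δ), ContMDiffAt 𝓘(ℝ, ℝ) model 2 γ' s := fun s hs =>
    ContMDiffAt.congr_of_eventuallyEq
      (((contMDiff_infty.1 (contMDiff_extChartAt_symm p) 2).contMDiffAt).comp s
        (hc s hs).1.contMDiffAt) (hγ'ev s hs)
  have heq : EqOn γ' γ (ray α b) := fun s hs => hγ'l s (EReal.coe_lt_coe_iff.1 hs.2)
  have hinter : ray α ((b + δ : ℝ) : EReal) ∩ Iio b = ray α b := ray_inter_Iio (by linarith)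
  have hright : ∀ s ∈ ray α ((b + δ : ℝ) : EReal), ¬ s < b → s ∈ Ioo (b - δ) (b + δ) :=
    fun s hs hsb => ⟨by linarith [not_lt.1 hsb], EReal.coe_lt_coe_iff.1 hs.2⟩
  have hleft : ∀ s ∈ ray α ((b + δ : ℝ) : EReal), s < b → s ∈ ray α b := fun s hs hsb =>
    hinter ▸ ⟨hs, hsb⟩
  have hρ : ∀ s ∈ Ioo (b - δ) (b + δ), ambRho a (incl (γ' s)) ≠ 0 := fun s hs => by
    rw [hγ'J s hs]
    exact (hc s hs).2.1
  refine fun hmax => hmax ⟨((b + δ : ℝ) : EReal), γ', EReal.coe_lt_coe_iff.2 (by linarith), ?_, heq⟩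
  refine ⟨fun s hs => ?_, fun s hs => ?_, fun s hs => ?_⟩
  · by_cases hsb : s < b
    · rw [hγ'l s hsb]
      exact hγ.mapsTo (hleft s hs hsb)
    · by_contra hK
      exact hρ s (hright s hs hsb) ((rhoSq_eq_zero_iff ha _).2 hK)
  · by_cases hsb : s < b
    · have h1 : ContMDiffWithinAt 𝓘(ℝ, ℝ) model 2 γ' (ray α b) s :=
        (hγ.contMDiffOn s (hleft s hs hsb)).congr heq (hγ'l s hsb)
      rw [← hinter] at h1
      exact (contMDiffWithinAt_inter (Iio_mem_nhds hsb)).1 h1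
    · exact (hsm s (hright s hs hsb)).contMDiffWithinAt
  · by_cases hsb : s < b
    -- This covers the end point `α`, where derivatives are one-sided and the ambient equation is
    -- not available.
    · exact fun w => geodesic_equation_congr (metric M a) isOpen_Iio hinter heq (hleft s hs hsb) w
        (hγ.equation s (hleft s hs hsb) w)
    · have hsJ := hright s hs hsb
      have hαs : α < s := (hα.trans_lt hb).trans_le (not_lt.1 hsb)
      have he : (fun τ => param p (c τ)) =ᶠ[𝓝 s] fun τ => incl (γ' τ) := by
        filter_upwards [hγ'ev s hsJ] with τ hτ
        rw [hτ, param]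
      exact (geodesic_equation_iff M a (ray_mem_nhds hαs hs.2) (hsm s hsJ) (hρ s hsJ)).2
        ((hc s hsJ).2.2.1.congr he)

end Kerr

/-! ### The reduced system, derivatives of the metric and Noether's identity. -/

namespace Kerr

open PseudoRiemannian

/-- The horizon function `Δ = r² - 2Mr + a²`. -/
def delta (M a r : ℝ) : ℝ := r ^ 2 - 2 * M * r + a ^ 2

/-- The function `P = (r² + a²) E - a L` of `r`. -/
def radialP (a E L r : ℝ) : ℝ := (r ^ 2 + a ^ 2) * E - a * L

/-- The function `D = L - a E sin² θ` of `z = cos θ`. -/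
def angularD (a E L z : ℝ) : ℝ := L - a * E * (1 - z ^ 2)

/-- A system of functions of the affine parameter obtained from a null geodesic with energy `E` and
angular momentum `L`: `t = t^*`, `r`, `z = cos θ` and `w = g(γ', ∂_r)`. -/
structure ReducedSystem (M a E L : ℝ) (I : Set ℝ) (t r z w t' r' : ℝ → ℝ) : Prop where
  hasDerivAt_t : ∀ s ∈ I, HasDerivAt t (t' s) s
  hasDerivAt_r : ∀ s ∈ I, HasDerivAt r (r' s) s
  continuousOn_z : ContinuousOn z I
  sq_z_le : ∀ s ∈ I, z s ^ 2 ≤ 1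
  rho_ne_zero : ∀ s ∈ I, r s ^ 2 + a ^ 2 * z s ^ 2 ≠ 0
  time : ∀ s ∈ I, (r s ^ 2 + a ^ 2 * z s ^ 2) * t' s
    = (r s ^ 2 + a ^ 2) * w s + a * angularD a E L (z s)
  radial : ∀ s ∈ I, (r s ^ 2 + a ^ 2 * z s ^ 2) * r' s
    = delta M a (r s) * w s - radialP a E L (r s)
  hasDerivAt_w : ∀ s ∈ I, HasDerivAt w
    (w s * ((2 * r s * E - (r s - M) * w s) / (r s ^ 2 + a ^ 2 * z s ^ 2))) s
  carter_zero : ∀ s ∈ I, w s * (2 * radialP a E L (r s) - delta M a (r s) * w s) = 0 →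
    angularD a E L (z s) = 0
  nontrivial : ∀ s ∈ I, w s = 0 → r' s ≠ 0

/-- The generator of rotations about the axis. -/
def rotation (X : Amb) : Amb := (0, 0, !₂[-X.2.2 1, X.2.2 0, 0])

/-- Derivatives of the metric are computed along straight lines; these may leave the sphere, since
the metric extends to the ambient space. -/
lemma fderiv_ambMetric_apply {M a : ℝ} {X : Amb} (hX : ambRho a X ≠ 0) (W U : Amb) {d : ℝ}
    (h : HasDerivAt (fun ε : ℝ => ambMetric M a (X + ε • W) U U) d 0) :
    fderiv ℝ (ambMetric M a) X W U U = d := by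
  have hG : HasFDerivAt (ambMetric M a) (fderiv ℝ (ambMetric M a) X) X :=
    ((contDiffAt_ambMetric M a hX (n := 1)).differentiableAt (by simp)).hasFDerivAt
  have hl : HasDerivAt (fun ε : ℝ => X + ε • W) W 0 := by
    simpa using ((hasDerivAt_id (0 : ℝ)).smul_const W).const_add X
  have h1 : HasDerivAt (fun ε : ℝ => ambMetric M a (X + ε • W))
      (fderiv ℝ (ambMetric M a) X W) 0 := by
    have := HasFDerivAt.comp_hasDerivAt_of_eq (l := ambMetric M a) (y := X) (0 : ℝ) hG hl (by simp)
    exact this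
  have h2 := (h1.clm_apply (hasDerivAt_const (0 : ℝ) U)).clm_apply (hasDerivAt_const (0 : ℝ) U)
  have h3 := h2.unique h
  simpa using h3

lemma fderiv_ambMetric_dt {M a : ℝ} {X : Amb} (hX : ambRho a X ≠ 0) (U : Amb) :
    fderiv ℝ (ambMetric M a) X (1, 0, 0) U U = 0 := by
  refine fderiv_ambMetric_apply hX _ U ?_
  have : (fun ε : ℝ => ambMetric M a (X + ε • ((1, 0, 0) : Amb)) U U)
      = fun _ => ambMetric M a X U U := by
    funext ε
    simp [ambMetric_apply, ambAxial_apply, ambRho]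
  rw [this]
  exact hasDerivAt_const _ _

lemma fderiv_ambMetric_dr {M a : ℝ} {X : Amb} (hX : ambRho a X ≠ 0) (U : Amb) :
    fderiv ℝ (ambMetric M a) X (0, 1, 0) U U
      = (2 * M * ambRho a X - 4 * M * X.2.1 ^ 2) / ambRho a X ^ 2
          * (U.1 - a * ambAxial X U) ^ 2
        + 2 * X.2.1 * (U.2.2 0 ^ 2 + U.2.2 1 ^ 2 + U.2.2 2 ^ 2) := by
  refine fderiv_ambMetric_apply hX _ U ?_
  set w := U.1 - a * ambAxial X U with hw
  set m := U.2.2 0 ^ 2 + U.2.2 1 ^ 2 + U.2.2 2 ^ 2 with hm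
  set k := -(U.1 * U.1) + (U.1 * U.2.1 + U.2.1 * U.1)
      - a * (ambAxial X U * U.2.1 + U.2.1 * ambAxial X U)
      + a ^ 2 * (ambAxial X U * ambAxial X U) with hk
  have he : (fun ε : ℝ => ambMetric M a (X + ε • ((0, 1, 0) : Amb)) U U)
      = fun ε => k + 2 * M * (X.2.1 + ε) / ((X.2.1 + ε) ^ 2 + a ^ 2 * X.2.2 2 ^ 2) * w ^ 2
        + ((X.2.1 + ε) ^ 2 + a ^ 2 * X.2.2 2 ^ 2) * m := by
    funext ε
    have h1 : ambAxial (X + ε • ((0, 1, 0) : Amb)) U = ambAxial X U := by simp [ambAxial_apply]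
    have h2 : ambRho a (X + ε • ((0, 1, 0) : Amb))
        = (X.2.1 + ε) ^ 2 + a ^ 2 * X.2.2 2 ^ 2 := by simp [ambRho]
    have h3 : (X + ε • ((0, 1, 0) : Amb)).2.1 = X.2.1 + ε := by simp
    rw [ambMetric_apply, h1, h2, h3]
    ring
  rw [he]
  have hX' : (X.2.1 + 0) ^ 2 + a ^ 2 * X.2.2 2 ^ 2 ≠ 0 := by rw [add_zero]; exact hX
  have d1 : HasDerivAt (fun ε : ℝ => X.2.1 + ε) 1 0 := (hasDerivAt_id (0 : ℝ)).const_add _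
  have d2 : HasDerivAt (fun ε : ℝ => (X.2.1 + ε) ^ 2 + a ^ 2 * X.2.2 2 ^ 2) (2 * X.2.1) 0 := by
    simpa using (d1.pow 2).add_const (a ^ 2 * X.2.2 2 ^ 2)
  have d3 := ((((d1.const_mul (2 * M)).div d2 hX').mul_const (w ^ 2)).const_add k).add
    (d2.mul_const m)
  refine d3.congr_deriv ?_
  rw [add_zero]
  unfold ambRho
  ring

/-- This is the Killing equation of the rotation field. The rotation is linear, so its derivative
along a curve with velocity `U` is `rotation U`; Noether's identity then yields conservation of L.
-/
lemma fderiv_ambMetric_rotation {M a : ℝ} {X : Amb} (hX : ambRho a X ≠ 0) (U : Amb) :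
    fderiv ℝ (ambMetric M a) X (rotation X) U U / 2 + ambMetric M a X U (rotation U) = 0 := by
  set A' : ℝ := -(X.2.2 1 * U.2.2 1) - X.2.2 0 * U.2.2 0 with hA'
  set f : ℝ := 2 * M * X.2.1 / ambRho a X with hf
  have key : fderiv ℝ (ambMetric M a) X (rotation X) U U
      = -2 * a * f * (U.1 - a * ambAxial X U) * A' - 2 * a * A' * U.2.1
        + 2 * a ^ 2 * ambAxial X U * A' := by
    refine fderiv_ambMetric_apply hX _ U ?_
    set k := -(U.1 * U.1) + (U.1 * U.2.1 + U.2.1 * U.1)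
      + ambRho a X * (U.2.2 0 * U.2.2 0 + U.2.2 1 * U.2.2 1 + U.2.2 2 * U.2.2 2) with hk
    have he : (fun ε : ℝ => ambMetric M a (X + ε • rotation X) U U)
        = fun ε => k + f * (U.1 - a * (ambAxial X U + ε * A')) ^ 2
          - 2 * a * U.2.1 * (ambAxial X U + ε * A') + a ^ 2 * (ambAxial X U + ε * A') ^ 2 := by
      funext ε
      have h1 : ambAxial (X + ε • rotation X) U = ambAxial X U + ε * A' := by
        simp [ambAxial_apply, rotation, hA']
        ring
      have h2 : ambRho a (X + ε • rotation X) = ambRho a X := by simp [ambRho, rotation]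
      have h3 : (X + ε • rotation X).2.1 = X.2.1 := by simp [rotation]
      rw [ambMetric_apply, h1, h2, h3, hk, hf]
      ring
    rw [he]
    have d1 : HasDerivAt (fun ε : ℝ => ambAxial X U + ε * A') A' 0 := by
      simpa using ((hasDerivAt_id (0 : ℝ)).mul_const A').const_add (ambAxial X U)
    have d2 := (((((d1.const_mul a).const_sub U.1).pow 2).const_mul f).const_add k).sub
      (d1.const_mul (2 * a * U.2.1)) |>.add ((d1.pow 2).const_mul (a ^ 2))
    refine d2.congr_deriv ?_
    simp
    ring
  have h4 : ambAxial X (rotation U) = -A' := by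
    simp [ambAxial_apply, rotation, hA']
  rw [key, ambMetric_apply, h4]
  simp [rotation]
  ring

/-- Noether's identity for the metric `ambMetric M a`. -/
lemma hasDerivAt_momentum {M a : ℝ} {X : ℝ → Amb} {s : ℝ} (hX : ContDiffAt ℝ 2 X s)
    (hρ : ambRho a (X s) ≠ 0) (he : AmbientEquation M a X s) {W : ℝ → Amb} {W' : Amb}
    (hW : HasDerivAt W W' s) (ht : inner ℝ (X s).2.2 (W s).2.2 = 0) :
    HasDerivAt (fun τ => ambMetric M a (X τ) (deriv X τ) (W τ))
      (fderiv ℝ (ambMetric M a) (X s) (W s) (deriv X s) (deriv X s) / 2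
        + ambMetric M a (X s) (deriv X s) W') s := by
  have hG : HasFDerivAt (ambMetric M a) (fderiv ℝ (ambMetric M a) (X s)) (X s) :=
    ((contDiffAt_ambMetric M a hρ (n := 1)).differentiableAt (by simp)).hasFDerivAt
  have h1 : HasDerivAt (fun τ => ambMetric M a (X τ))
      (fderiv ℝ (ambMetric M a) (X s) (deriv X s)) s :=
    HasFDerivAt.comp_hasDerivAt (l := ambMetric M a) s hG (hX.differentiableAt (by simp)).hasDerivAt
  have h2 := (h1.clm_apply (differentiableAt_deriv hX).hasDerivAt).clm_apply hW
  refine h2.congr_deriv ?_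
  -- The product rule gives the terms with the second derivative and with the derivative of the
  -- metric along the curve; the geodesic equation tested against `W s` replaces them by half the
  -- derivative of the metric along `W s`.
  have := he (W s) ht
  simp only [eulerLagrange] at this
  simp only [add_apply]
  linarith

end Kerr

/-! ### Pointwise identities for first integrals, and the reduction. -/

namespace Kerr

open PseudoRiemannian

section Pointwise

variable {M a : ℝ} {X U : Amb}

lemma ambMetric_dr : ambMetric M a X U (0, 1, 0) = U.1 - a * ambAxial X U := by
  rw [ambMetric_apply]
  simp [ambAxial_apply]

lemma ambMetric_dt : -ambMetric M a X U (1, 0, 0)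
    = U.1 - 2 * M * X.2.1 / ambRho a X * (U.1 - a * ambAxial X U) - U.2.1 := by
  rw [ambMetric_apply]
  simp [ambAxial_apply]
  ring

lemma ambMetric_rotation (hn : X.2.2 0 ^ 2 + X.2.2 1 ^ 2 + X.2.2 2 ^ 2 = 1) :
    ambMetric M a X U (rotation X)
      = (1 - X.2.2 2 ^ 2) * (-(a * (2 * M * X.2.1 / ambRho a X) * (U.1 - a * ambAxial X U))
          - a * U.2.1 + a ^ 2 * ambAxial X U) + ambRho a X * ambAxial X U := by
  have h : ambAxial X (rotation X) = 1 - X.2.2 2 ^ 2 := by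
    simp [ambAxial_apply, rotation]
    linarith
  rw [ambMetric_apply, h]
  simp only [ambAxial_apply]
  simp [rotation]
  ring

lemma angularD_eq (hn : X.2.2 0 ^ 2 + X.2.2 1 ^ 2 + X.2.2 2 ^ 2 = 1) :
    angularD a (-ambMetric M a X U (1, 0, 0)) (ambMetric M a X U (rotation X)) (X.2.2 2)
      = ambRho a X * ambAxial X U
        - a * (1 - X.2.2 2 ^ 2) * ambMetric M a X U (0, 1, 0) := by
  rw [angularD, ambMetric_dt, ambMetric_rotation hn, ambMetric_dr]
  ring

lemma time_eq (hn : X.2.2 0 ^ 2 + X.2.2 1 ^ 2 + X.2.2 2 ^ 2 = 1) :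
    ambRho a X * U.1 = (X.2.1 ^ 2 + a ^ 2) * ambMetric M a X U (0, 1, 0)
      + a * angularD a (-ambMetric M a X U (1, 0, 0)) (ambMetric M a X U (rotation X))
        (X.2.2 2) := by
  rw [angularD_eq hn, ambMetric_dr]
  simp only [ambRho]
  ring

/-- Starts from P = ρ² E - a D, in which the angular velocity enters only through w once E and D are
expanded. -/
lemma radialP_eq (hρ : ambRho a X ≠ 0) (hn : X.2.2 0 ^ 2 + X.2.2 1 ^ 2 + X.2.2 2 ^ 2 = 1) :
    radialP a (-ambMetric M a X U (1, 0, 0)) (ambMetric M a X U (rotation X)) X.2.1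
      = delta M a X.2.1 * ambMetric M a X U (0, 1, 0) - ambRho a X * U.2.1 := by
  have h1 : radialP a (-ambMetric M a X U (1, 0, 0)) (ambMetric M a X U (rotation X)) X.2.1
      = ambRho a X * (-ambMetric M a X U (1, 0, 0))
        - a * angularD a (-ambMetric M a X U (1, 0, 0)) (ambMetric M a X U (rotation X))
          (X.2.2 2) := by
    simp only [radialP, angularD, ambRho]
    ring
  rw [h1, angularD_eq hn, ambMetric_dt, ambMetric_dr, mul_sub, mul_sub, ← mul_assoc,
    mul_div_cancel₀ _ hρ]
  simp only [delta, ambRho]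
  ring

/-- Nullity solved for the angular speed: every term on the right has a factor w. This is behind
both the Carter identity and the linear form of the equation for w. -/
lemma null_eq (h0 : ambMetric M a X U U = 0) :
    ambRho a X * (U.2.2 0 ^ 2 + U.2.2 1 ^ 2 + U.2.2 2 ^ 2)
      = (1 - 2 * M * X.2.1 / ambRho a X) * ambMetric M a X U (0, 1, 0) ^ 2
        + 2 * a * ambAxial X U * ambMetric M a X U (0, 1, 0)
        - 2 * U.2.1 * ambMetric M a X U (0, 1, 0) := by
  rw [ambMetric_apply] at h0
  rw [ambMetric_dr]
  linear_combination h0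

/-- The Carter constant as a sum of squares. -/
lemma carter_eq (hρ : ambRho a X ≠ 0) (hn : X.2.2 0 ^ 2 + X.2.2 1 ^ 2 + X.2.2 2 ^ 2 = 1)
    (h0 : ambMetric M a X U U = 0) :
    ambMetric M a X U (0, 1, 0) * (2 * radialP a (-ambMetric M a X U (1, 0, 0))
        (ambMetric M a X U (rotation X)) X.2.1
        - delta M a X.2.1 * ambMetric M a X U (0, 1, 0))
      = (ambRho a X * U.2.2 0 + a * ambMetric M a X U (0, 1, 0) * X.2.2 1) ^ 2
        + (ambRho a X * U.2.2 1 - a * ambMetric M a X U (0, 1, 0) * X.2.2 0) ^ 2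
        + (ambRho a X * U.2.2 2) ^ 2 := by
  have h1 := null_eq h0
  have h2 : ambRho a X * (1 - 2 * M * X.2.1 / ambRho a X) = ambRho a X - 2 * M * X.2.1 := by
    field_simp
  rw [radialP_eq hρ hn]
  set w := ambMetric M a X U (0, 1, 0)
  have h3 : ambRho a X * (ambRho a X * (U.2.2 0 ^ 2 + U.2.2 1 ^ 2 + U.2.2 2 ^ 2))
      = (ambRho a X - 2 * M * X.2.1) * w ^ 2 + ambRho a X * (2 * a * ambAxial X U * w
        - 2 * U.2.1 * w) := by
    rw [h1, ← h2]
    ring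
  have h4 : X.2.2 0 ^ 2 + X.2.2 1 ^ 2 = 1 - X.2.2 2 ^ 2 := by linarith
  have h5 : delta M a X.2.1 = ambRho a X - 2 * M * X.2.1 + a ^ 2 * (1 - X.2.2 2 ^ 2) := by
    simp only [delta, ambRho]
    ring
  rw [h5]
  simp only [ambAxial_apply] at h3
  linear_combination (-a ^ 2 * w ^ 2) * h4 - h3

/-- Substituting `null_eq` for the angular speed makes the r-derivative of the metric divisible by
w. Hence w solves a homogeneous equation and either vanishes identically or never. -/
lemma fderiv_dr_eq (hρ : ambRho a X ≠ 0) (h0 : ambMetric M a X U U = 0) :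
    fderiv ℝ (ambMetric M a) X (0, 1, 0) U U / 2 = ambMetric M a X U (0, 1, 0)
      * ((2 * X.2.1 * -ambMetric M a X U (1, 0, 0)
        - (X.2.1 - M) * ambMetric M a X U (0, 1, 0)) / ambRho a X) := by
  have h1 := null_eq h0
  rw [fderiv_ambMetric_dr hρ, ambMetric_dt]
  rw [ambMetric_dr] at *
  set w := U.1 - a * ambAxial X U with hw
  have hU : U.1 = w + a * ambAxial X U := by rw [hw]; ring
  rw [hU]
  have h2 : U.2.2 0 ^ 2 + U.2.2 1 ^ 2 + U.2.2 2 ^ 2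
      = ((1 - 2 * M * X.2.1 / ambRho a X) * w ^ 2 + 2 * a * ambAxial X U * w
        - 2 * U.2.1 * w) / ambRho a X := by
    rw [← h1]
    field_simp
  rw [h2]
  field_simp
  ring

end Pointwise

/-- The open interval `(α, β)`. -/
def openRay (α : ℝ) (β : EReal) : Set ℝ := {s | α < s ∧ (s : EReal) < β}

lemma isOpen_openRay (α : ℝ) (β : EReal) : IsOpen (openRay α β) :=
  isOpen_Ioi.inter (isOpen_Iio.preimage continuous_coe_real_ereal)

lemma ordConnected_openRay (α : ℝ) (β : EReal) : (openRay α β).OrdConnected :=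
  ⟨fun _ hx _ hy _ hz => ⟨hx.1.trans_le hz.1, (EReal.coe_le_coe_iff.2 hz.2).trans_lt hy.2⟩⟩

lemma exists_const_of_hasDerivAt_zero {I : Set ℝ} (hI : IsOpen I) (hI' : I.OrdConnected)
    {f : ℝ → ℝ} (hf : ∀ s ∈ I, HasDerivAt f 0 s) : ∃ c, ∀ s ∈ I, f s = c :=
  hI.exists_is_const_of_deriv_eq_zero hI'.isPreconnected
    (fun s hs => (hf s hs).differentiableAt.differentiableWithinAt) fun s hs => (hf s hs).deriv

lemma incl_sphere (p : Total) :
    (incl p).2.2 0 ^ 2 + (incl p).2.2 1 ^ 2 + (incl p).2.2 2 ^ 2 = 1 := by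
  have h := p.2.2.2
  rw [mem_sphere_zero_iff_norm] at h
  have h1 := EuclideanSpace.norm_sq_eq (p.2.2 : EuclideanSpace ℝ (Fin 3))
  rw [h, Fin.sum_univ_three] at h1
  simp only [Real.norm_eq_abs, sq_abs] at h1
  have h2 : (incl p).2.2 = (p.2.2 : EuclideanSpace ℝ (Fin 3)) := rfl
  rw [h2]
  linarith

/-- The reduction of the null geodesic equation to a system for `t^*`, `r` and `w`, together with
the expression of the Carter constant. -/
theorem exists_reducedSystem {M a α : ℝ} {β : EReal} (ha : a ≠ 0) {γ : ℝ → Total}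
    (hγ : IsNullGeodesicOn (metric M a) Kstar γ (ray α β)) :
    ∃ E L : ℝ, ∃ w : ℝ → ℝ,
      ReducedSystem M a E L (openRay α β) (fun s => (incl (γ s)).1) (fun s => (incl (γ s)).2.1)
        (fun s => (incl (γ s)).2.2 2) w (fun s => (deriv (fun τ => incl (γ τ)) s).1)
        (fun s => (deriv (fun τ => incl (γ τ)) s).2.1) ∧
      ∀ s ∈ openRay α β,
        w s * (2 * radialP a E L (incl (γ s)).2.1 - delta M a (incl (γ s)).2.1 * w s)
          = (ambRho a (incl (γ s)) * (deriv (fun τ => incl (γ τ)) s).2.2 0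
              + a * w s * (incl (γ s)).2.2 1) ^ 2
            + (ambRho a (incl (γ s)) * (deriv (fun τ => incl (γ τ)) s).2.2 1
              - a * w s * (incl (γ s)).2.2 0) ^ 2
            + (ambRho a (incl (γ s)) * (deriv (fun τ => incl (γ τ)) s).2.2 2) ^ 2 := by
  set X : ℝ → Amb := fun τ => incl (γ τ) with hXdef
  have hX : ∀ s ∈ openRay α β, ContDiffAt ℝ 2 X s := fun s hs =>
    contDiffAt_geodesic hγ.toIsGeodesicOn hs.1 hs.2
  have hρ : ∀ s ∈ openRay α β, ambRho a (X s) ≠ 0 := fun s hs =>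
    rho_ne_zero_geodesic ha hγ.toIsGeodesicOn hs.1.le hs.2
  have he : ∀ s ∈ openRay α β, AmbientEquation M a X s := fun s hs =>
    ambientEquation_geodesic ha hγ.toIsGeodesicOn hs.1 hs.2
  have h0 : ∀ s ∈ openRay α β, ambMetric M a (X s) (deriv X s) (deriv X s) = 0 := fun s hs =>
    null_geodesic hγ hs.1 hs.2
  have hU : ∀ s ∈ openRay α β, deriv X s ≠ 0 := fun s hs => deriv_ne_zero_geodesic hγ hs.1 hs.2
  have hn : ∀ s, (X s).2.2 0 ^ 2 + (X s).2.2 1 ^ 2 + (X s).2.2 2 ^ 2 = 1 := fun s => incl_sphere _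
  have hXd : ∀ s ∈ openRay α β, HasDerivAt X (deriv X s) s := fun s hs =>
    ((hX s hs).differentiableAt (by simp)).hasDerivAt
  obtain ⟨E, hE⟩ := exists_const_of_hasDerivAt_zero (isOpen_openRay α β) (ordConnected_openRay α β)
    (f := fun τ => -ambMetric M a (X τ) (deriv X τ) (1, 0, 0)) fun s hs => by
      refine (hasDerivAt_momentum (hX s hs) (hρ s hs) (he s hs)
        (hasDerivAt_const s ((1, 0, 0) : Amb)) (by simp)).neg.congr_deriv ?_
      rw [fderiv_ambMetric_dt (hρ s hs), map_zero]
      simp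
  have hrot : ∀ s ∈ openRay α β, HasDerivAt (fun τ => rotation (X τ)) (rotation (deriv X s)) s := by
    intro s hs
    have h1 : HasDerivAt (fun τ => (X τ).2.2 0) ((deriv X s).2.2 0) s :=
      (dn 0).hasFDerivAt.comp_hasDerivAt s (hXd s hs)
    have h2 : HasDerivAt (fun τ => (X τ).2.2 1) ((deriv X s).2.2 1) s :=
      (dn 1).hasFDerivAt.comp_hasDerivAt s (hXd s hs)
    refine (hasDerivAt_const s (0 : ℝ)).prodMk ((hasDerivAt_const s (0 : ℝ)).prodMk ?_)
    have h3 : HasDerivAt (fun τ => ![-(X τ).2.2 1, (X τ).2.2 0, 0])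
        ![-(deriv X s).2.2 1, (deriv X s).2.2 0, 0] s := by
      refine hasDerivAt_pi.2 fun i => ?_
      fin_cases i
      · exact h2.neg
      · exact h1
      · exact hasDerivAt_const s (0 : ℝ)
    exact (PiLp.hasFDerivAt_toLp 2 (𝕜 := ℝ) _).comp_hasDerivAt s h3
  obtain ⟨L, hL⟩ := exists_const_of_hasDerivAt_zero (isOpen_openRay α β) (ordConnected_openRay α β)
    (f := fun τ => ambMetric M a (X τ) (deriv X τ) (rotation (X τ))) fun s hs => by
      refine (hasDerivAt_momentum (hX s hs) (hρ s hs) (he s hs) (hrot s hs) ?_).congr_deriv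
        (fderiv_ambMetric_rotation (hρ s hs) _)
      rw [inner_amb]
      simp [rotation]
      ring
  have hcarter := fun s hs => carter_eq (hρ s hs) (hn s) (h0 s hs)
  have hD := fun s => angularD_eq (M := M) (a := a) (U := deriv X s) (hn s)
  have htime := fun s => time_eq (M := M) (a := a) (U := deriv X s) (hn s)
  have hrad := fun s hs => radialP_eq (M := M) (U := deriv X s) (hρ s hs) (hn s)
  have hdr := fun s hs => fderiv_dr_eq (hρ s hs) (h0 s hs)
  refine ⟨E, L, fun s => ambMetric M a (X s) (deriv X s) (0, 1, 0), ?_, fun s hs => ?_⟩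
  swap
  · have := hcarter s hs
    rw [hE s hs, hL s hs] at this
    exact this
  have hzero : ∀ s ∈ openRay α β, ambMetric M a (X s) (deriv X s) (0, 1, 0)
      * (2 * radialP a E L (X s).2.1
        - delta M a (X s).2.1 * ambMetric M a (X s) (deriv X s) (0, 1, 0)) = 0 →
      angularD a E L ((X s).2.2 2) = 0 ∧ (ambMetric M a (X s) (deriv X s) (0, 1, 0) = 0 →
        (deriv X s).2.2 = 0) := by
    intro s hs hK
    have h1 := hcarter s hs
    rw [hE s hs, hL s hs, hK] at h1
    obtain ⟨e0, e1, e2⟩ := eq_zero_of_sum_sq_eq_zero h1.symm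
    constructor
    · have h2 := hD s
      rw [hE s hs, hL s hs] at h2
      rw [h2, ambAxial_apply]
      -- D is a combination of the first two squared quantities with coefficients the coordinates x
      -- and y of the sphere, so it vanishes with the Carter constant.
      linear_combination (X s).2.2 0 * e1 - (X s).2.2 1 * e0
        + a * ambMetric M a (X s) (deriv X s) (0, 1, 0) * hn s
    · intro hw
      rw [hw] at e0 e1
      ext i
      fin_cases i
      · exact (mul_eq_zero.1 (by simpa using e0)).resolve_left (hρ s hs)
      · exact (mul_eq_zero.1 (by simpa using e1)).resolve_left (hρ s hs)
      · exact (mul_eq_zero.1 e2).resolve_left (hρ s hs)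
  have htime' : ∀ s ∈ openRay α β, ambRho a (X s) * (deriv X s).1
      = ((X s).2.1 ^ 2 + a ^ 2) * ambMetric M a (X s) (deriv X s) (0, 1, 0)
        + a * angularD a E L ((X s).2.2 2) := by
    intro s hs
    have := htime s
    rwa [hE s hs, hL s hs] at this
  refine ⟨fun s hs => ?_, fun s hs => ?_, fun s hs => ?_, fun s hs => ?_, hρ, htime',
    fun s hs => ?_, fun s hs => ?_, fun s hs h => (hzero s hs h).1, fun s hs hw hr => ?_⟩
  · exact dt.hasFDerivAt.comp_hasDerivAt s (hXd s hs)
  · exact dr.hasFDerivAt.comp_hasDerivAt s (hXd s hs)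
  · exact ((dn 2).continuous.continuousAt.comp (hXd s hs).continuousAt).continuousWithinAt
  · nlinarith [hn s, sq_nonneg ((X s).2.2 0), sq_nonneg ((X s).2.2 1)]
  · have := hrad s hs
    rw [hE s hs, hL s hs] at this
    rw [this]
    simp only [ambRho]
    ring
  · refine (hasDerivAt_momentum (hX s hs) (hρ s hs) (he s hs)
        (hasDerivAt_const s ((0, 1, 0) : Amb)) (by simp)).congr_deriv ?_
    rw [map_zero, add_zero, hdr s hs, hE s hs]
    rfl
  -- With w = 0 the Carter constant vanishes, so D, t' and the angular velocity are 0; if r' were 0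
  -- too, the velocity would vanish.
  · refine hU s hs ?_
    obtain ⟨h1, h2⟩ := hzero s hs (by rw [hw, zero_mul])
    have h3 := htime' s hs
    rw [hw, h1, mul_zero, mul_zero, add_zero] at h3
    exact Prod.ext ((mul_eq_zero.1 h3).resolve_left (hρ s hs)) (Prod.ext hr (h2 hw))

end Kerr

/-! ### Growth lemmas and the function regular at the horizon. -/

namespace Kerr

/-- By Darboux's theorem a derivative without zeros has constant sign, so no continuity of `f'` is
needed; then `f` or `-f` grows at least linearly. -/
lemma not_bounded_of_le_abs_deriv {f f' : ℝ → ℝ} {s₁ c T : ℝ} (hc : 0 < c)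
    (hf : ∀ s, s₁ ≤ s → HasDerivAt f (f' s) s) (hf' : ∀ s, s₁ ≤ s → c ≤ |f' s|)
    (hT : ∀ s, s₁ ≤ s → |f s| ≤ T) : False := by
  have key : ∀ {g g' : ℝ → ℝ}, (∀ s, s₁ ≤ s → HasDerivAt g (g' s) s) → (∀ s, s₁ ≤ s → c ≤ g' s) →
      (∀ s, s₁ ≤ s → |g s| ≤ T) → False := by
    intro g g' hg hg' hgT
    have hT0 : 0 ≤ T := (abs_nonneg _).trans (hgT s₁ le_rfl)
    -- Up to `s₂` the function grows by at least `2 * T + 1`, more than the length of `[-T, T]`.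
    set s₂ := s₁ + (2 * T + 1) / c with hs₂
    have hle : s₁ ≤ s₂ := by
      have : 0 ≤ (2 * T + 1) / c := by positivity
      linarith
    have h := (convex_Ici s₁).mul_sub_le_image_sub_of_le_deriv (f := g) (C := c)
      (fun s hs => (hg s hs).continuousAt.continuousWithinAt)
      (fun s hs => (hg s (interior_subset hs)).differentiableAt.differentiableWithinAt)
      (fun s hs => by
        rw [(hg s (interior_subset hs)).deriv]
        exact hg' s (interior_subset hs)) s₁ self_mem_Ici s₂ hle hle
    have h2 : c * (s₂ - s₁) = 2 * T + 1 := by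
      rw [hs₂]
      field_simp
      ring
    have h3 := abs_le.1 (hgT s₂ hle)
    have h4 := abs_le.1 (hgT s₁ le_rfl)
    linarith
  rcases hasDerivWithinAt_forall_lt_or_forall_gt_of_forall_ne (convex_Ici s₁)
    (fun s hs => (hf s hs).hasDerivWithinAt) (m := 0)
    (fun s hs h => by
      have := hf' s hs
      rw [h, abs_zero] at this
      linarith) with h | h
  · exact key (g := fun s => -f s) (fun s hs => (hf s hs).neg)
      (fun s hs => by
        have := hf' s hs
        rwa [abs_of_neg (h s hs)] at this)
      fun s hs => by
        rw [abs_neg]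
        exact hT s hs
  · exact key hf (fun s hs => by
        have := hf' s hs
        rwa [abs_of_pos (h s hs)] at this) hT

/-- A solution of a linear homogeneous differential equation of first order. -/
lemma exists_exponent {I : Set ℝ} (hI : IsOpen I) (hI' : I.OrdConnected) {w h : ℝ → ℝ} {s₁ : ℝ}
    (hs₁ : s₁ ∈ I) (hh : ContinuousOn h I) (hw : ∀ s ∈ I, HasDerivAt w (w s * h s) s) :
    ∃ H : ℝ → ℝ, (∀ s ∈ I, HasDerivAt H (h s) s) ∧ ∀ s ∈ I, w s = w s₁ * Real.exp (H s) := by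
  have hH : ∀ s ∈ I, HasDerivAt (fun s => ∫ τ in s₁..s, h τ) (h s) s := by
    intro s hs
    refine intervalIntegral.integral_hasDerivAt_right
      ((hh.mono (hI'.uIcc_subset hs₁ hs)).intervalIntegrable) ?_ (hh.continuousAt (hI.mem_nhds hs))
    exact hh.stronglyMeasurableAtFilter hI s hs
  refine ⟨_, hH, ?_⟩
  have hc : ∀ s ∈ I, HasDerivAt (fun s => w s * Real.exp (-∫ τ in s₁..s, h τ)) 0 s := by
    intro s hs
    refine ((hw s hs).mul (hH s hs).neg.exp).congr_deriv ?_
    ring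
  obtain ⟨c, hc⟩ := exists_const_of_hasDerivAt_zero hI hI' hc
  intro s hs
  have h1 : w s₁ = c := by simpa using hc s₁ hs₁
  rw [h1, ← hc s hs, mul_assoc, ← Real.exp_add]
  simp

/-- The data of a horizon `r = r_h`, with `r_o` the radius of the other horizon. -/
structure IsHorizonPair (M a rh ro : ℝ) : Prop where
  mass_pos : 0 < M
  pos : 0 < rh
  ne : rh ≠ ro
  add : rh + ro = 2 * M
  mul : rh * ro = a ^ 2

/-- The derivative of the function `Z` in `ReducedSystem.hasDerivAt_regular`. -/
def regularDeriv (M a E L rh ro r z : ℝ) : ℝ :=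
  ((rh - M) * a * angularD a E L z + 4 * M * rh * E * r
    + ((rh - M) - 2 * M ^ 2 / (r - ro)) * radialP a E L r) / (r ^ 2 + a ^ 2 * z ^ 2)

namespace IsHorizonPair

variable {M a rh ro : ℝ}

lemma delta_eq (h : IsHorizonPair M a rh ro) (r : ℝ) : delta M a r = (r - rh) * (r - ro) := by
  rw [delta, ← h.add, ← h.mul]
  ring

/-- Fixes a neighbourhood of the horizon in which ρ² is positive and the other root of Δ is avoided.
-/
lemma exists_radius (h : IsHorizonPair M a rh ro) :
    ∃ δ > 0, ∀ r, |r - rh| ≤ δ → 0 < r ∧ r - ro ≠ 0 := by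
  have hne : 0 < |rh - ro| := abs_pos.2 (sub_ne_zero.2 h.ne)
  refine ⟨min (rh / 2) (|rh - ro| / 2), lt_min (by linarith [h.pos]) (by linarith), fun r hr => ?_⟩
  have h1 := abs_le.1 (hr.trans (min_le_left _ _))
  refine ⟨by linarith [h.pos], fun h0 => ?_⟩
  have h2 := hr.trans (min_le_right _ _)
  rw [show r = ro by linarith, abs_sub_comm] at h2
  linarith

lemma exists_regular_bound (M a E L rh ro : ℝ) {δ : ℝ}
    (hδ : ∀ r, |r - rh| ≤ δ → 0 < r ∧ r - ro ≠ 0) :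
    ∃ B, ∀ r z, |r - rh| ≤ δ → z ^ 2 ≤ 1 →
      |regularDeriv M a E L rh ro r z| ≤ B ∧ |Real.log (r - ro)| ≤ B := by
  have hmem : ∀ r, r ∈ Icc (rh - δ) (rh + δ) → |r - rh| ≤ δ := fun r hr =>
    abs_le.2 ⟨by linarith [hr.1], by linarith [hr.2]⟩
  obtain ⟨B₁, hB₁⟩ := ((isCompact_Icc (a := rh - δ) (b := rh + δ)).prod
    (isCompact_Icc (a := (-1 : ℝ)) (b := 1))).exists_bound_of_continuousOn
    (f := fun x : ℝ × ℝ => regularDeriv M a E L rh ro x.1 x.2) (by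
      unfold regularDeriv angularD radialP
      refine ContinuousOn.div ?_ (by fun_prop) ?_
      · refine ContinuousOn.add (by fun_prop) (ContinuousOn.mul (ContinuousOn.sub (by fun_prop) ?_)
          (by fun_prop))
        exact ContinuousOn.div (by fun_prop) (by fun_prop) fun x hx => (hδ _ (hmem _ hx.1)).2
      · intro x hx
        have := (hδ _ (hmem _ hx.1)).1
        positivity)
  obtain ⟨B₂, hB₂⟩ := (isCompact_Icc (a := rh - δ) (b := rh + δ)).exists_bound_of_continuousOn
    (f := fun r => Real.log (r - ro))
    (ContinuousOn.log (by fun_prop) fun r hr => (hδ _ (hmem _ hr)).2)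
  refine ⟨max B₁ B₂, fun r z hr hz => ?_⟩
  have hr' : r ∈ Icc (rh - δ) (rh + δ) := ⟨by linarith [(abs_le.1 hr).1], by linarith [(abs_le.1 hr).2]⟩
  have hz' : z ∈ Icc (-1 : ℝ) 1 := abs_le.1 ((sq_le_one_iff_abs_le_one z).1 hz)
  exact ⟨(hB₁ (r, z) ⟨hr', hz'⟩).trans (le_max_left _ _), (hB₂ r hr').trans (le_max_right _ _)⟩

end IsHorizonPair

namespace ReducedSystem

variable {M a E L : ℝ} {I : Set ℝ} {t r z w t' r' : ℝ → ℝ}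

lemma exists_exponent (h : ReducedSystem M a E L I t r z w t' r') (hI : IsOpen I)
    (hI' : I.OrdConnected) {s₁ : ℝ} (hs₁ : s₁ ∈ I) :
    ∃ H : ℝ → ℝ, (∀ s ∈ I, HasDerivAt H
        ((2 * r s * E - (r s - M) * w s) / (r s ^ 2 + a ^ 2 * z s ^ 2)) s) ∧
      ∀ s ∈ I, w s = w s₁ * Real.exp (H s) := by
  refine Kerr.exists_exponent hI hI' hs₁ ?_ h.hasDerivAt_w
  have hr : ContinuousOn r I := fun s hs => (h.hasDerivAt_r s hs).continuousAt.continuousWithinAt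
  have hw : ContinuousOn w I := fun s hs => (h.hasDerivAt_w s hs).continuousAt.continuousWithinAt
  have hz := h.continuousOn_z
  exact ContinuousOn.div (by fun_prop) (by fun_prop) h.rho_ne_zero

/-- A combination of `t^*`, `log |w|` and a function of `r` with a derivative that is regular at
the horizon. -/
lemma hasDerivAt_regular (h : ReducedSystem M a E L I t r z w t' r') {rh ro : ℝ}
    (hp : IsHorizonPair M a rh ro) {H : ℝ → ℝ} {s : ℝ} (hs : s ∈ I)
    (hH : HasDerivAt H ((2 * r s * E - (r s - M) * w s) / (r s ^ 2 + a ^ 2 * z s ^ 2)) s)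
    (hr : r s - ro ≠ 0) :
    -- `H` stands for log|w| up to a constant, and makes sense even if w is identically 0. The real
    -- logarithm is that of the absolute value, so the formula also serves the inner horizon, where
    -- `r - ro` is negative.
    HasDerivAt (fun s => (rh - M) * t s + 2 * M * rh * H s - (rh - M) * r s
      + 2 * M ^ 2 * Real.log (r s - ro)) (regularDeriv M a E L rh ro (r s) (z s)) s := by
  have h1 := (((h.hasDerivAt_t s hs).const_mul (rh - M)).add (hH.const_mul (2 * M * rh))).sub
    ((h.hasDerivAt_r s hs).const_mul (rh - M)) |>.add
    ((((h.hasDerivAt_r s hs).sub_const ro).log hr).const_mul (2 * M ^ 2))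
  refine h1.congr_deriv ?_
  have hρ := h.rho_ne_zero s hs
  have ht : t' s = ((r s ^ 2 + a ^ 2) * w s + a * angularD a E L (z s))
      / (r s ^ 2 + a ^ 2 * z s ^ 2) := by
    rw [← h.time s hs]
    field_simp
  have hr' : r' s = (delta M a (r s) * w s - radialP a E L (r s))
      / (r s ^ 2 + a ^ 2 * z s ^ 2) := by
    rw [← h.radial s hs]
    field_simp
  have hM : M = (rh + ro) / 2 := by linarith [hp.add]
  -- With r² + a² - Δ = 2Mr and Δ/(r - ro) = r - rh, the coefficient of w/ρ² is 2M[(rh - M)r - rh(r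
  -- - M) + M(r - rh)] = 0.
  rw [ht, hr', hp.delta_eq, regularDeriv, ← hp.mul]
  set ρ := r s ^ 2 + rh * ro * z s ^ 2 with hρdef
  have hρ' : ρ ≠ 0 := by rw [hρdef, hp.mul]; exact hρ
  set P := radialP a E L (r s)
  set D := angularD a E L (z s)
  rw [hM]
  field_simp
  ring

/-- The derivative is 2w'(P - Δw) + 2wr'(2rE - (r - M)w). By the radial equation and the equation
for w, the two terms are -2ρ² r'w' and 2ρ² r'w'. -/
lemma carter_const (h : ReducedSystem M a E L I t r z w t' r') (hI : IsOpen I)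
    (hI' : I.OrdConnected) :
    ∃ K, ∀ s ∈ I, w s * (2 * radialP a E L (r s) - delta M a (r s) * w s) = K := by
  refine exists_const_of_hasDerivAt_zero hI hI' fun s hs => ?_
  have hr := h.hasDerivAt_r s hs
  have hw := h.hasDerivAt_w s hs
  have hP : HasDerivAt (fun s => radialP a E L (r s)) (2 * r s * r' s * E) s := by
    unfold radialP
    refine ((((hr.pow 2).add_const (a ^ 2)).mul_const E).sub_const (a * L)).congr_deriv ?_
    simp
  have hD : HasDerivAt (fun s => delta M a (r s)) (2 * r s * r' s - 2 * M * r' s) s := by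
    unfold delta
    refine (((hr.pow 2).sub (hr.const_mul (2 * M))).add_const (a ^ 2)).congr_deriv ?_
    simp
  refine (hw.mul ((hP.const_mul 2).sub (hD.mul hw))).congr_deriv ?_
  have hρ := h.rho_ne_zero s hs
  have hr' : r' s = (delta M a (r s) * w s - radialP a E L (r s))
      / (r s ^ 2 + a ^ 2 * z s ^ 2) := by
    rw [← h.radial s hs]
    field_simp
  rw [hr']
  simp only [Pi.mul_apply, Pi.sub_apply]
  field_simp
  ring

end ReducedSystem

end Kerr

/-! ### Bounded and unbounded parameter intervals near a horizon. -/

namespace Kerr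

open PseudoRiemannian

namespace ReducedSystem

variable {M a E L : ℝ} {I : Set ℝ} {t r z w t' r' : ℝ → ℝ}

lemma mono (h : ReducedSystem M a E L I t r z w t' r') {J : Set ℝ} (hJ : J ⊆ I) :
    ReducedSystem M a E L J t r z w t' r' where
  hasDerivAt_t s hs := h.hasDerivAt_t s (hJ hs)
  hasDerivAt_r s hs := h.hasDerivAt_r s (hJ hs)
  continuousOn_z := h.continuousOn_z.mono hJ
  sq_z_le s hs := h.sq_z_le s (hJ hs)
  rho_ne_zero s hs := h.rho_ne_zero s (hJ hs)
  time s hs := h.time s (hJ hs)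
  radial s hs := h.radial s (hJ hs)
  hasDerivAt_w s hs := h.hasDerivAt_w s (hJ hs)
  carter_zero s hs := h.carter_zero s (hJ hs)
  nontrivial s hs := h.nontrivial s (hJ hs)

/-- Near a horizon, and for bounded `t^*`, the function `w` is bounded on bounded intervals. -/
lemma exists_bound_w {rh ro δ T s₀ s₁ b : ℝ}
    (h : ReducedSystem M a E L (Ioo s₀ b) t r z w t' r') (hp : IsHorizonPair M a rh ro)
    (hδ : ∀ r, |r - rh| ≤ δ → 0 < r ∧ r - ro ≠ 0)
    (hr : ∀ s ∈ Ioo s₀ b, |r s - rh| ≤ δ) (ht : ∀ s ∈ Ioo s₀ b, |t s| ≤ T)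
    (hs₁ : s₁ ∈ Ioo s₀ b) : ∃ N, ∀ s ∈ Ico s₁ b, |w s| ≤ N := by
  obtain ⟨H, hH, hwH⟩ := h.exists_exponent isOpen_Ioo ordConnected_Ioo hs₁
  obtain ⟨B, hB⟩ := IsHorizonPair.exists_regular_bound M a E L rh ro hδ
  set Z : ℝ → ℝ := fun s => (rh - M) * t s + 2 * M * rh * H s - (rh - M) * r s
      + 2 * M ^ 2 * Real.log (r s - ro) with hZ
  have hZd : ∀ s ∈ Ioo s₀ b, HasDerivAt Z (regularDeriv M a E L rh ro (r s) (z s)) s := fun s hs =>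
    h.hasDerivAt_regular hp hs (hH s hs) (hδ _ (hr s hs)).2
  have hc : 0 < 2 * M * rh := mul_pos (mul_pos two_pos hp.mass_pos) hp.pos
  have hB0 : 0 ≤ B := (abs_nonneg _).trans (hB _ _ (hr s₁ hs₁) (h.sq_z_le s₁ hs₁)).1
  -- The first two terms bound `Z`, by the mean value inequality on an interval of length at most `b
  -- - s₁`; the others bound the parts of `Z` besides `2 * M * rh * H`. As `2 * M * rh` is positive,
  -- `H` is bounded above.
  set S := |Z s₁| + B * (b - s₁) + |rh - M| * T + |rh - M| * (|rh| + δ) + 2 * M ^ 2 * B with hS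
  refine ⟨|w s₁| * Real.exp (S / (2 * M * rh)), fun s hs => ?_⟩
  have hsub : ∀ τ ∈ Icc s₁ s, τ ∈ Ioo s₀ b := fun τ hτ =>
    ⟨hs₁.1.trans_le hτ.1, hτ.2.trans_lt hs.2⟩
  have hsI := hsub s (right_mem_Icc.2 hs.1)
  have h1 : |Z s - Z s₁| ≤ B * (s - s₁) := norm_image_sub_le_of_norm_deriv_le_segment'
    (fun τ hτ => (hZd τ (hsub τ hτ)).hasDerivWithinAt)
    (fun τ hτ => (hB _ _ (hr τ (hsub τ ⟨hτ.1, hτ.2.le⟩))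
      (h.sq_z_le τ (hsub τ ⟨hτ.1, hτ.2.le⟩))).1) s (right_mem_Icc.2 hs.1)
  have h2 : Z s ≤ |Z s₁| + B * (b - s₁) := by
    have : B * (s - s₁) ≤ B * (b - s₁) := by gcongr; exact hs.2.le
    linarith [(abs_le.1 h1).2, le_abs_self (Z s₁)]
  have h3 : |(rh - M) * t s| ≤ |rh - M| * T := by
    rw [abs_mul]
    gcongr
    exact ht s hsI
  have h4 : |(rh - M) * r s| ≤ |rh - M| * (|rh| + δ) := by
    rw [abs_mul]
    gcongr
    calc |r s| = |rh + (r s - rh)| := by ring_nf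
      _ ≤ |rh| + |r s - rh| := abs_add_le _ _
      _ ≤ |rh| + δ := by gcongr; exact hr s hsI
  have h5 : |2 * M ^ 2 * Real.log (r s - ro)| ≤ 2 * M ^ 2 * B := by
    rw [abs_mul, abs_of_nonneg (by positivity : (0 : ℝ) ≤ 2 * M ^ 2)]
    gcongr
    exact (hB _ _ (hr s hsI) (h.sq_z_le s hsI)).2
  have h6 : H s * (2 * M * rh) ≤ S := by
    have : Z s = (rh - M) * t s + 2 * M * rh * H s - (rh - M) * r s
      + 2 * M ^ 2 * Real.log (r s - ro) := rfl
    linarith [(abs_le.1 h3).1, (abs_le.1 h4).2, (abs_le.1 h5).1]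
  rw [hwH s hsI, abs_mul, Real.abs_exp]
  gcongr
  exact (le_div_iff₀ hc).2 h6

/-- On an unbounded interval the coordinate `t^*` is unbounded near a horizon. -/
lemma unbounded_of_tendsto {rh ro δ T s₀ : ℝ} (ha : a ≠ 0)
    (h : ReducedSystem M a E L (Ioi s₀) t r z w t' r') (hp : IsHorizonPair M a rh ro)
    (hδ : ∀ r, |r - rh| ≤ δ → 0 < r ∧ r - ro ≠ 0)
    (hr : ∀ s ∈ Ioi s₀, |r s - rh| ≤ δ) (ht : ∀ s ∈ Ioi s₀, |t s| ≤ T)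
    (hlim : Tendsto r atTop (𝓝 rh)) : False := by
  obtain ⟨K, hK⟩ := h.carter_const isOpen_Ioi ordConnected_Ioi
  have hρpos : ∀ s ∈ Ioi s₀, 0 < r s ^ 2 + a ^ 2 * z s ^ 2 := fun s hs => by
    have := (hδ _ (hr s hs)).1
    positivity
  have hρle : ∀ s ∈ Ioi s₀, r s ^ 2 + a ^ 2 * z s ^ 2 ≤ r s ^ 2 + a ^ 2 := fun s hs => by
    nlinarith [h.sq_z_le s hs, sq_nonneg a]
  have hPc : Tendsto (fun s => radialP a E L (r s)) atTop (𝓝 (radialP a E L rh)) :=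
    Tendsto.sub (Tendsto.mul (Tendsto.add (hlim.pow 2) tendsto_const_nhds) tendsto_const_nhds)
      tendsto_const_nhds
  have hΔ0 : delta M a rh = 0 := by rw [hp.delta_eq, sub_self, zero_mul]
  have hΔc : Tendsto (fun s => delta M a (r s)) atTop (𝓝 0) := by
    rw [← hΔ0]
    exact Tendsto.add (Tendsto.sub (hlim.pow 2) (tendsto_const_nhds.mul hlim)) tendsto_const_nhds
  by_cases hP : radialP a E L rh = 0
  · have hPE : ∀ s, radialP a E L (r s) = E * (r s ^ 2 - rh ^ 2) := fun s => by
      simp only [radialP] at hP ⊢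
      linear_combination hP
    by_cases hK0 : K = 0
    · have hD : ∀ s ∈ Ioi s₀, angularD a E L (z s) = 0 := fun s hs =>
        h.carter_zero s hs ((hK s hs).trans hK0)
      have hs₁ : s₀ + 1 ∈ Ioi s₀ := by simp
      -- Now P = E(r² - rh²), while D = 0 gives P = Eρ². The difference is E(a²z² + rh²) = 0.
      have hE : E = 0 := by
        have h1 := hD _ hs₁
        have h2 := hPE (s₀ + 1)
        have h3 : E * (a ^ 2 * z (s₀ + 1) ^ 2 + rh ^ 2) = 0 := by
          simp only [angularD, radialP] at h1 h2
          linear_combination h2 + a * h1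
        have h4 : a ^ 2 * z (s₀ + 1) ^ 2 + rh ^ 2 ≠ 0 := by
          have := hp.pos
          positivity
        exact (mul_eq_zero.1 h3).resolve_right h4
      have hL : L = 0 := by
        have h1 := hD _ hs₁
        rw [angularD, hE] at h1
        linarith
      have hP0 : ∀ s, radialP a E L (r s) = 0 := fun s => by rw [hPE, hE, zero_mul]
      have hw0 : ∀ s ∈ Ioi s₀, w s ≠ 0 := fun s hs h0 => by
        refine h.nontrivial s hs h0 ?_
        have h1 := h.radial s hs
        rw [h0, hP0, mul_zero, sub_zero] at h1
        exact (mul_eq_zero.1 h1).resolve_left (h.rho_ne_zero s hs)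
      -- With P = K = 0 the Carter identity reads Δw² = 0: the curve is contained in the horizon.
      have hrh : ∀ s ∈ Ioi s₀, r s = rh := fun s hs => by
        have h1 := hK s hs
        rw [hP0, hK0] at h1
        have h2 : delta M a (r s) * w s = 0 := by
          have := (mul_eq_zero.1 h1).resolve_left (hw0 s hs)
          linarith
        have h3 := (mul_eq_zero.1 h2).resolve_right (hw0 s hs)
        rw [hp.delta_eq] at h3
        exact sub_eq_zero.1 ((mul_eq_zero.1 h3).resolve_right (hδ _ (hr s hs)).2)
      obtain ⟨H, hH, hwH⟩ := h.exists_exponent isOpen_Ioi ordConnected_Ioi hs₁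
      obtain ⟨c, hc⟩ := exists_const_of_hasDerivAt_zero isOpen_Ioi ordConnected_Ioi fun s hs => by
        refine (h.hasDerivAt_regular hp hs (hH s hs) (hδ _ (hr s hs)).2).congr_deriv ?_
        rw [regularDeriv, hD s hs, hP0, hE]
        simp
      have hc2 : 0 < 2 * M * rh := mul_pos (mul_pos two_pos hp.mass_pos) hp.pos
      set S := c + (rh - M) * rh - 2 * M ^ 2 * Real.log (rh - ro) - |rh - M| * T with hS
      -- The regular function is constant here, so bounded `t` bounds `H` from below uniformly on an
      -- infinite interval.
      have hHS : ∀ s ∈ Ioi s₀, S / (2 * M * rh) ≤ H s := fun s hs => by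
        rw [div_le_iff₀ hc2]
        have h1 := hc s hs
        rw [hrh s hs] at h1
        have h2 : |(rh - M) * t s| ≤ |rh - M| * T := by
          rw [abs_mul]
          gcongr
          exact ht s hs
        linarith [(abs_le.1 h2).2]
      refine not_bounded_of_le_abs_deriv (f := t) (f' := t') (s₁ := s₀ + 1) (T := T)
        (c := |w (s₀ + 1)| * Real.exp (S / (2 * M * rh)))
        (mul_pos (abs_pos.2 (hw0 _ hs₁)) (Real.exp_pos _))
        (fun s hs => h.hasDerivAt_t s (hs₁.trans_le hs)) (fun s hs => ?_)
        fun s hs => ht s (hs₁.trans_le hs)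
      have hsI : s ∈ Ioi s₀ := hs₁.trans_le hs
      have h1 : |w (s₀ + 1)| * Real.exp (S / (2 * M * rh)) ≤ |w s| := by
        rw [hwH s hsI, abs_mul, Real.abs_exp]
        gcongr
        exact hHS s hsI
      refine h1.trans ?_
      have h2 := h.time s hsI
      rw [hD s hsI, mul_zero, add_zero] at h2
      have h3 := congrArg abs h2
      rw [abs_mul, abs_mul, abs_of_pos (hρpos s hsI),
        abs_of_pos ((hρpos s hsI).trans_le (hρle s hsI))] at h3
      have h4 := mul_le_mul_of_nonneg_right (hρle s hsI) (abs_nonneg (w s))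
      exact le_of_mul_le_mul_left (h4.trans h3.ge) (hρpos s hsI)
    · set D := |L| + |a * E| with hDdef
      -- `D` bounds the angular function, and `|w| ≥ N` gives (r² + a²)|w| - |a|D ≥ r² + a² ≥ ρ²,
      -- that is, |t'| ≥ 1.
      set N := 1 + D / |a| with hN
      have ha' : 0 < |a| := abs_pos.2 ha
      have hD0 : 0 ≤ D := by positivity
      have hN0 : 0 < N := by positivity
      have hlim2 : Tendsto (fun s => N * (2 * |radialP a E L (r s)| + |delta M a (r s)| * N)) atTop
          (𝓝 (N * (2 * |radialP a E L rh| + |(0 : ℝ)| * N))) :=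
        tendsto_const_nhds.mul ((tendsto_const_nhds.mul hPc.abs).add
          (hΔc.abs.mul tendsto_const_nhds))
      rw [hP, abs_zero, mul_zero, zero_mul, add_zero, mul_zero] at hlim2
      obtain ⟨s₁, hs₁⟩ := eventually_atTop.1
        ((hlim2.eventually (gt_mem_nhds (abs_pos.2 hK0))).and (eventually_gt_atTop s₀))
      refine not_bounded_of_le_abs_deriv (f := t) (f' := t') (s₁ := s₁) (T := T) one_pos
        (fun s hs => h.hasDerivAt_t s (hs₁ s hs).2) (fun s hs => ?_)
        fun s hs => ht s (hs₁ s hs).2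
      have hsI : s ∈ Ioi s₀ := (hs₁ s hs).2
      -- If |w| < N, then |K| ≤ N(2|P| + |Δ|N), which tends to 0; this contradicts K ≠ 0 for large
      -- `s`.
      have hwN : N ≤ |w s| := by
        by_contra! hlt
        have h1 : |K| ≤ N * (2 * |radialP a E L (r s)| + |delta M a (r s)| * N) := by
          rw [← hK s hsI, abs_mul]
          have h2 : |2 * radialP a E L (r s) - delta M a (r s) * w s|
              ≤ 2 * |radialP a E L (r s)| + |delta M a (r s)| * |w s| := by
            refine (abs_sub _ _).trans ?_
            rw [abs_mul, abs_mul, abs_two]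
          refine mul_le_mul hlt.le (h2.trans ?_) (abs_nonneg _) hN0.le
          gcongr
        exact absurd (hs₁ s hs).1 (not_lt.2 h1)
      have hDle : |angularD a E L (z s)| ≤ D := by
        refine (abs_sub _ _).trans ?_
        rw [hDdef, abs_mul]
        gcongr
        have h1 := h.sq_z_le s hsI
        have h2 : |1 - z s ^ 2| ≤ 1 := abs_le.2 ⟨by linarith, by linarith [sq_nonneg (z s)]⟩
        exact mul_le_of_le_one_right (abs_nonneg _) h2
      have h1 : r s ^ 2 + a ^ 2 ≤ |(r s ^ 2 + a ^ 2) * w s + a * angularD a E L (z s)| := by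
        have h2 : |(r s ^ 2 + a ^ 2) * w s| - |a * angularD a E L (z s)|
            ≤ |(r s ^ 2 + a ^ 2) * w s + a * angularD a E L (z s)| := by
          have := abs_sub_abs_le_abs_sub ((r s ^ 2 + a ^ 2) * w s) (-(a * angularD a E L (z s)))
          rwa [abs_neg, sub_neg_eq_add] at this
        rw [abs_mul, abs_mul, abs_of_nonneg (by positivity : 0 ≤ r s ^ 2 + a ^ 2)] at h2
        have h3 : |a| * |angularD a E L (z s)| ≤ |a| * D := by gcongr
        have h4 : (r s ^ 2 + a ^ 2) * N ≤ (r s ^ 2 + a ^ 2) * |w s| := by gcongr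
        have h5 : a ^ 2 * (D / |a|) = |a| * D := by
          rw [← sq_abs a]
          field_simp
        have h6 : 0 ≤ r s ^ 2 * (D / |a|) := by positivity
        rw [hN] at h4
        linarith
      rw [← h.time s hsI, abs_mul, abs_of_pos (hρpos s hsI)] at h1
      have h2 := (hρle s hsI).trans h1
      exact le_of_mul_le_mul_left (by linarith) (hρpos s hsI)
  · have hlim2 : Tendsto (fun s => radialP a E L (r s) ^ 2 - delta M a (r s) * K) atTop
        (𝓝 (radialP a E L rh ^ 2 - 0 * K)) := (hPc.pow 2).sub (hΔc.mul tendsto_const_nhds)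
    -- P² - ΔK = (P - Δw)² = (ρ² r')², with nonzero limit P(rh)²; so eventually |ρ² r'| ≥ |P(rh)|/2.
    have hlt : (radialP a E L rh / 2) ^ 2 < radialP a E L rh ^ 2 - 0 * K := by
      have : 0 < radialP a E L rh ^ 2 := by positivity
      linarith
    obtain ⟨s₁, hs₁⟩ := eventually_atTop.1
      ((hlim2.eventually (lt_mem_nhds hlt)).and (eventually_gt_atTop s₀))
    have hrle : ∀ s ∈ Ioi s₀, |r s| ≤ rh + δ := fun s hs => by
      rw [abs_of_pos (hδ _ (hr s hs)).1]
      linarith [(abs_le.1 (hr s hs)).2]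
    have hR : 0 < (rh + δ) ^ 2 + a ^ 2 := by positivity
    refine not_bounded_of_le_abs_deriv (f := r) (f' := r') (s₁ := s₁) (T := rh + δ)
      (c := |radialP a E L rh / 2| / ((rh + δ) ^ 2 + a ^ 2))
      (div_pos (abs_pos.2 (div_ne_zero hP two_ne_zero)) hR)
      (fun s hs => h.hasDerivAt_r s (hs₁ s hs).2) (fun s hs => ?_)
      fun s hs => hrle s (hs₁ s hs).2
    have hsI : s ∈ Ioi s₀ := (hs₁ s hs).2
    have h1 : (radialP a E L rh / 2) ^ 2 ≤ ((r s ^ 2 + a ^ 2 * z s ^ 2) * r' s) ^ 2 := by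
      rw [h.radial s hsI]
      refine (hs₁ s hs).1.le.trans_eq ?_
      rw [← hK s hsI]
      ring
    have h2 := sq_le_sq.1 h1
    rw [abs_mul ((r s ^ 2 + a ^ 2 * z s ^ 2)), abs_of_pos (hρpos s hsI)] at h2
    rw [div_le_iff₀' hR]
    refine h2.trans (mul_le_mul_of_nonneg_right ?_ (abs_nonneg _))
    refine (hρle s hsI).trans ?_
    have := hrle s hsI
    rw [← sq_abs (r s)]
    gcongr

end ReducedSystem

end Kerr

/-! ### Velocity bounds and the conclusion. -/

namespace Kerr

open PseudoRiemannian

/-- Bounds for the functions that determine the velocity of a null geodesic. -/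
lemma exists_velocity_bound (M a E L rh ro N : ℝ) {δ : ℝ}
    (hδ : ∀ r, |r - rh| ≤ δ → 0 < r ∧ r - ro ≠ 0) :
    ∃ B, ∀ r z w, |r - rh| ≤ δ → z ^ 2 ≤ 1 → |w| ≤ N →
      |1 / (r ^ 2 + a ^ 2 * z ^ 2)| ≤ B ∧ |(r ^ 2 + a ^ 2) * w + a * angularD a E L z| ≤ B ∧
      |delta M a r * w - radialP a E L r| ≤ B ∧
      |w * (2 * radialP a E L r - delta M a r * w)| ≤ B := by
  have hmem : ∀ r, r ∈ Icc (rh - δ) (rh + δ) → |r - rh| ≤ δ := fun r hr =>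
    abs_le.2 ⟨by linarith [hr.1], by linarith [hr.2]⟩
  obtain ⟨B, hB⟩ := ((isCompact_Icc (a := rh - δ) (b := rh + δ)).prod
    ((isCompact_Icc (a := (-1 : ℝ)) (b := 1)).prod (isCompact_Icc (a := -N) (b := N)))
    ).exists_bound_of_continuousOn
    (f := fun x : ℝ × ℝ × ℝ => (1 / (x.1 ^ 2 + a ^ 2 * x.2.1 ^ 2),
      (x.1 ^ 2 + a ^ 2) * x.2.2 + a * angularD a E L x.2.1,
      delta M a x.1 * x.2.2 - radialP a E L x.1,
      x.2.2 * (2 * radialP a E L x.1 - delta M a x.1 * x.2.2))) (by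
      unfold angularD radialP delta
      refine ContinuousOn.prodMk (ContinuousOn.div (by fun_prop) (by fun_prop) ?_)
        (ContinuousOn.prodMk (by fun_prop) (ContinuousOn.prodMk (by fun_prop) (by fun_prop)))
      intro x hx
      have := (hδ _ (hmem _ hx.1)).1
      positivity)
  refine ⟨B, fun r z w hr hz hw => ?_⟩
  have h := hB (r, z, w) ⟨⟨by linarith [(abs_le.1 hr).1], by linarith [(abs_le.1 hr).2]⟩,
    abs_le.1 ((sq_le_one_iff_abs_le_one z).1 hz), abs_le.1 hw⟩
  obtain ⟨h1, h⟩ := norm_prod_le_iff.1 h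
  obtain ⟨h2, h⟩ := norm_prod_le_iff.1 h
  obtain ⟨h3, h4⟩ := norm_prod_le_iff.1 h
  exact ⟨h1, h2, h3, h4⟩

lemma abs_le_of_mul_eq {ρ u f B : ℝ} (hρ : ρ ≠ 0) (h : ρ * u = f) (h1 : |1 / ρ| ≤ B)
    {B' : ℝ} (h2 : |f| ≤ B') : |u| ≤ B * B' := by
  have : u = 1 / ρ * f := by rw [← h]; field_simp
  rw [this, abs_mul]
  exact mul_le_mul h1 h2 (abs_nonneg _) ((abs_nonneg _).trans h1)

lemma norm_euclidean_le {x : EuclideanSpace ℝ (Fin 3)} {B : ℝ} (h0 : |x 0| ≤ B) (h1 : |x 1| ≤ B)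
    (h2 : |x 2| ≤ B) : ‖x‖ ≤ 2 * B := by
  have hB : 0 ≤ B := (abs_nonneg _).trans h0
  refine le_of_sq_le_sq ?_ (by positivity)
  rw [EuclideanSpace.norm_sq_eq, Fin.sum_univ_three]
  simp only [Real.norm_eq_abs]
  have e0 := pow_le_pow_left₀ (abs_nonneg _) h0 2
  have e1 := pow_le_pow_left₀ (abs_nonneg _) h1 2
  have e2 := pow_le_pow_left₀ (abs_nonneg _) h2 2
  linarith [sq_nonneg B]

lemma abs_incl_le (p : Total) (i : Fin 3) : |(incl p).2.2 i| ≤ 1 := by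
  have h := PiLp.norm_apply_le (p.2.2 : EuclideanSpace ℝ (Fin 3)) i
  rwa [mem_sphere_zero_iff_norm.1 p.2.2.2] at h

/-- A bound for the angular velocity in terms of the Carter constant. -/
lemma norm_angular_velocity_le {ρ a w N B : ℝ} {x v : EuclideanSpace ℝ (Fin 3)} (hρ : ρ ≠ 0)
    (hB : |1 / ρ| ≤ B) (hx : ∀ i, |x i| ≤ 1) (hw : |w| ≤ N)
    (h : (ρ * v 0 + a * w * x 1) ^ 2 + (ρ * v 1 - a * w * x 0) ^ 2 + (ρ * v 2) ^ 2 ≤ B) :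
    ‖v‖ ≤ 2 * (B * (B + 1 + |a| * N)) := by
  have hN0 : 0 ≤ N := (abs_nonneg _).trans hw
  have hsq : ∀ k : ℝ, k ^ 2 ≤ B → |k| ≤ B + 1 := fun k hk => by
    rw [← sq_abs] at hk
    nlinarith [abs_nonneg k, sq_nonneg (|k| - 1)]
  have hax : ∀ i, |a * w * x i| ≤ |a| * N := fun i => by
    rw [abs_mul, abs_mul]
    calc |a| * |w| * |x i| ≤ |a| * |w| * 1 := by gcongr; exact hx i
      _ ≤ |a| * N := by rw [mul_one]; gcongr
  refine norm_euclidean_le ?_ ?_ ?_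
  · refine abs_le_of_mul_eq hρ (f := (ρ * v 0 + a * w * x 1) - a * w * x 1) (by ring) hB
      ((abs_sub _ _).trans (add_le_add (hsq _ ?_) (hax 1)))
    linarith [sq_nonneg (ρ * v 1 - a * w * x 0), sq_nonneg (ρ * v 2)]
  · refine abs_le_of_mul_eq hρ (f := (ρ * v 1 - a * w * x 0) + a * w * x 0) (by ring) hB
      ((abs_add_le _ _).trans (add_le_add (hsq _ ?_) (hax 0)))
    linarith [sq_nonneg (ρ * v 0 + a * w * x 1), sq_nonneg (ρ * v 2)]
  · refine abs_le_of_mul_eq hρ rfl hB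
      ((hsq _ ?_).trans (le_add_of_nonneg_right (by positivity)))
    linarith [sq_nonneg (ρ * v 0 + a * w * x 1), sq_nonneg (ρ * v 1 - a * w * x 0)]

lemma atTop_le_toEnd : atTop ≤ toEnd ⊤ := by
  refine map_le_iff_le_comap.1 (tendsto_nhdsWithin_iff.2 ⟨?_, ?_⟩)
  · exact EReal.tendsto_coe_atTop
  · exact Eventually.of_forall fun s => EReal.coe_lt_top s

lemma nhdsLT_le_toEnd (b : ℝ) : 𝓝[<] b ≤ toEnd b := by
  refine map_le_iff_le_comap.1 (tendsto_nhdsWithin_iff.2 ⟨?_, ?_⟩)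
  · exact (continuous_coe_real_ereal.tendsto b).mono_left nhdsWithin_le_nhds
  · filter_upwards [self_mem_nhdsWithin] with s hs using EReal.coe_lt_coe_iff.2 hs

lemma exists_isHorizonPair {M a : ℝ} (ha : a ≠ 0) (haM : |a| < M) {γ : ℝ → Total} {β : EReal}
    (h : TendsToHorizon M a γ β) : ∃ rh ro, IsHorizonPair M a rh ro ∧
      Tendsto (fun s => radius (γ s)) (toEnd β) (𝓝 rh) := by
  have hM : 0 < M := (abs_nonneg a).trans_lt haM
  have ha2 : 0 < a ^ 2 := by positivity
  have h1 : 0 < M ^ 2 - a ^ 2 := by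
    have := sq_lt_sq' (by linarith [abs_nonneg a]) haM
    rw [sq_abs] at this
    linarith
  have hs := Real.sq_sqrt h1.le
  have hs0 := Real.sqrt_pos.2 h1
  have hsM : √(M ^ 2 - a ^ 2) < M := by
    rw [Real.sqrt_lt' hM]
    linarith
  rcases h with h | h
  · refine ⟨_, rMinus M a, ⟨hM, ?_, ?_, ?_, ?_⟩, h⟩ <;> simp only [rPlus, rMinus]
    · linarith
    · intro h; linarith
    · ring
    · linear_combination -hs
  · refine ⟨_, rPlus M a, ⟨hM, ?_, ?_, ?_, ?_⟩, h⟩ <;> simp only [rPlus, rMinus]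
    · linarith
    · intro h; linarith
    · ring
    · linear_combination -hs

/-- Near a horizon, the velocity of a null geodesic on a bounded interval is bounded if the
coordinate `t^*` is. -/
lemma exists_bound_velocity {M a α b rh ro T : ℝ} (ha : a ≠ 0) {γ : ℝ → Total} (hαb : α < b)
    (hγ : IsNullGeodesicOn (metric M a) Kstar γ (ray α b)) (hp : IsHorizonPair M a rh ro)
    (hlim : Tendsto (fun s => radius (γ s)) (𝓝[<] b) (𝓝 rh))
    (hT : ∀ s ∈ ray α b, |tStar (γ s)| ≤ T) :
    ∃ s₀ N, α ≤ s₀ ∧ s₀ < b ∧ ∀ s ∈ Ioo s₀ b, ‖deriv (fun τ => incl (γ τ)) s‖ ≤ N := by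
  obtain ⟨E, L, w, hR, hC⟩ := exists_reducedSystem ha hγ
  obtain ⟨δ, hδ0, hδ⟩ := hp.exists_radius
  obtain ⟨s₀, hs₀, hs₀'⟩ := (mem_nhdsLT_iff_exists_Ioo_subset).1
    ((hlim.eventually (Metric.closedBall_mem_nhds rh hδ0)).and (eventually_lt_ray hαb))
  have hsub : Ioo s₀ b ⊆ openRay α b := fun s hs => (hs₀' hs).2
  have hr : ∀ s ∈ Ioo s₀ b, |(incl (γ s)).2.1 - rh| ≤ δ := fun s hs => (hs₀' hs).1
  obtain ⟨s₁, hs₁⟩ := exists_between (show s₀ < b from hs₀)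
  obtain ⟨N, hN⟩ := (hR.mono hsub).exists_bound_w hp hδ hr
    (fun s hs => hT s ⟨(hsub hs).1.le, (hsub hs).2⟩) hs₁
  obtain ⟨B, hB⟩ := exists_velocity_bound M a E L rh ro N hδ
  refine ⟨s₁, B * B + 2 * (B * (B + 1 + |a| * N)), ?_, hs₁.2, fun s hs => ?_⟩
  · exact (hsub hs₁).1.le
  have hsI : s ∈ Ioo s₀ b := ⟨hs₁.1.trans hs.1, hs.2⟩
  have hsJ := hsub hsI
  have hwN := hN s ⟨hs.1.le, hs.2⟩
  obtain ⟨b1, b2, b3, b4⟩ := hB _ _ (w s) (hr s hsI) (hR.sq_z_le s hsJ) hwN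
  have hB0 : 0 ≤ B := (abs_nonneg _).trans b1
  have hN0 : 0 ≤ N := (abs_nonneg _).trans hwN
  have hρ := hR.rho_ne_zero s hsJ
  have ht := abs_le_of_mul_eq hρ (hR.time s hsJ) b1 b2
  have hr' := abs_le_of_mul_eq hρ (hR.radial s hsJ) b1 b3
  have hcar := hC s hsJ
  -- The Carter constant is bounded along with w, and it is the sum of the squares that contain the
  -- angular velocity.
  have hn' := norm_angular_velocity_le hρ b1 (abs_incl_le (γ s)) hwN
    (hcar.symm.le.trans (abs_le.1 b4).2)
  have hBN : 0 ≤ 2 * (B * (B + 1 + |a| * N)) := by positivity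
  have hBB : 0 ≤ B * B := by positivity
  refine norm_prod_le_iff.2 ⟨?_, norm_prod_le_iff.2 ⟨?_, ?_⟩⟩
  · exact ht.trans (by linarith)
  · exact hr'.trans (by linarith)
  · linarith

end Kerr

end

open PseudoRiemannian Kerr in
theorem mainTheorem3 (M a : ℝ) (ha : a ≠ 0) (haM : |a| < M)
    (α : ℝ) (β : EReal) (hαβ : (α : EReal) < β) (γ : ℝ → Kerr.Total)
    (hγ : PseudoRiemannian.IsNullGeodesicOn (Kerr.metric M a) Kerr.Kstar γ
      (PseudoRiemannian.ray α β))
    (hmax : PseudoRiemannian.IsMaximalAtEnd (Kerr.metric M a) Kerr.Kstar γ α β)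
    (hhor : Kerr.TendsToHorizon M a γ β) :
    ¬ Kerr.IsBoundedInKstar γ (PseudoRiemannian.ray α β) := by
  rintro ⟨C, hC, hCK, hγC⟩
  obtain ⟨rh, ro, hp, hlim⟩ := exists_isHorizonPair ha haM hhor
  obtain ⟨T, hT⟩ := hC.exists_bound_of_continuousOn (f := tStar) continuous_fst.continuousOn
  have hT' : ∀ s ∈ ray α β, |tStar (γ s)| ≤ T := fun s hs => hT _ (hγC ⟨s, hs, rfl⟩)
  induction β with
  | bot => exact not_lt_bot hαβ
  | coe b =>
    have hαb := EReal.coe_lt_coe_iff.1 hαβ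
    obtain ⟨s₀, N, h1, h2, h3⟩ := exists_bound_velocity ha hαb hγ hp
      (hlim.mono_left (nhdsLT_le_toEnd b)) hT'
    exact not_isMaximalAtEnd_of_bounded_velocity ha h1 h2 hγ.toIsGeodesicOn hC hCK hγC h3 hmax
  | top =>
    obtain ⟨E, L, w, hR, -⟩ := exists_reducedSystem ha hγ
    obtain ⟨δ, hδ0, hδ⟩ := hp.exists_radius
    have hlim' := hlim.mono_left atTop_le_toEnd
    obtain ⟨s₀, hs₀⟩ := eventually_atTop.1
      ((hlim'.eventually (Metric.closedBall_mem_nhds rh hδ0)).and (eventually_gt_atTop α))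
    have hsub : Ioi s₀ ⊆ openRay α ⊤ := fun s hs => ⟨(hs₀ s (le_of_lt hs)).2, EReal.coe_lt_top s⟩
    exact (hR.mono hsub).unbounded_of_tendsto ha hp hδ (fun s hs => (hs₀ s (le_of_lt hs)).1)
      (fun s hs => hT' s ⟨(hsub hs).1.le, (hsub hs).2⟩) hlim'
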